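/- Let $\lambda\in(0,1)$. For $n\ge 1$ put $W_n=(\lambda^n,\lambda^{n-1}]$, and let $F_\lambda:(0,1]\to(0,1]$ be the map $$F_\lambda(x)=\begin{cases}\dfrac{x-\lambda}{1-\lambda} & \text{if } x\in W_1,\\[2mm] \dfrac{x-\lambda^n}{\lambda(1-\lambda)} & \text{if } x\in W_n,\ n\ge 2.\end{cases}$$ Set also $F_\lambda(0)=0$. Define the hyperbolic dimension $$\dim_{\mathrm{hyp}}(F_\lambda)=\sup\{\dim_H(\Lambda):\Lambda\subset[0,1]\text{ compact},\ F_\lambda(\Lambda)\subseteq\Lambda,\ 0\notin\Lambda\}$$ and the escaping set $$\Omega_\lambda=\{x\in[0,1]:\lim_{n\to\infty}F_\lambda^n(x)=0\}.$$ Here $\dim_H$ denotes the Hausdorff dimension. Then for every $\lambda\in(0,1)$ $$\dim_{\mathrm{hyp}}(F_{1-\lambda})=\dim_H(\Omega_\lambda)=\begin{cases}-\dfrac{\log 4}{\log[\lambda(1-\lambda)]} & \text{if }\lambda\le\frac12,\\[2mm] 1 & \text{if }\lambda\ge\frac12.\end{cases}$$ -/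

import Mathlib

open Set Filter Topology

noncomputable section

namespace PiecewiseLinear

/-- The interval `W_n = (lam ^ n, lam ^ (n - 1)]`, used for `n ≥ 1`. For `0 < lam < 1` these
intervals partition `(0, 1]`. -/
def W (lam : ℝ) (n : ℕ) : Set ℝ := Ioc (lam ^ n) (lam ^ (n - 1))

/-- For `x ∈ (0, 1]`, the unique `n ≥ 1` with `x ∈ W_n` (see `index_eq`). -/
def index (lam x : ℝ) : ℕ := sInf {n : ℕ | 1 ≤ n ∧ x ∈ W lam n}

open Classical in
/-- The countably piecewise linear map `F_lam : (0, 1] → (0, 1]`, equal to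
`(x - lam) / (1 - lam)` on `W_1` and to `(x - lam ^ n) / (lam * (1 - lam))` on `W_n`, `n ≥ 2`.
Outside `(0, 1]` the map is given the value `0`; in particular `0` is fixed. -/
def F (lam x : ℝ) : ℝ :=
  if x ∈ Ioc (0 : ℝ) 1 then
    if x ∈ W lam 1 then (x - lam) / (1 - lam)
    else (x - lam ^ index lam x) / (lam * (1 - lam))
  else 0

/-- The hyperbolic dimension: the supremum of the Hausdorff dimensions of the compact
`F_lam`-invariant sets that do not contain `0`. -/
def hypDim (lam : ℝ) : ENNReal :=
  ⨆ (K : Set ℝ) (_ : K ⊆ Icc 0 1 ∧ IsCompact K ∧ MapsTo (F lam) K K ∧ (0 : ℝ) ∉ K), dimH K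

/-- The escaping set: the points of `[0, 1]` whose orbit converges to `0`. -/
def escapingSet (lam : ℝ) : Set ℝ :=
  {x ∈ Icc (0 : ℝ) 1 | Tendsto (fun n : ℕ => (F lam)^[n] x) atTop (𝓝 0)}

theorem index_eq {lam x : ℝ} (h0 : 0 < lam) (h1 : lam < 1) {n : ℕ} (hn : 1 ≤ n)
    (hx : x ∈ W lam n) : index lam x = n := by
  have key : ∀ a b : ℕ, 1 ≤ b → x ∈ W lam a → x ∈ W lam b → b ≤ a := by
    intro a b hb ha hxb
    by_contra hlt
    have hle : lam ^ (b - 1) ≤ lam ^ a := pow_le_pow_of_le_one h0.le h1.le (by omega)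
    have h2 := ha.1
    have h3 := hxb.2
    linarith
  have hmem : index lam x ∈ {n : ℕ | 1 ≤ n ∧ x ∈ W lam n} := Nat.sInf_mem ⟨n, hn, hx⟩
  exact le_antisymm (key _ _ hmem.1 hx hmem.2) (key _ _ hn hmem.2 hx)

theorem W_subset {lam : ℝ} (h0 : 0 < lam) (h1 : lam < 1) (n : ℕ) : W lam n ⊆ Ioc 0 1 :=
  fun _ hx => ⟨(pow_pos h0 n).trans hx.1, hx.2.trans (pow_le_one₀ h0.le h1.le)⟩

theorem exists_mem_W {lam x : ℝ} (h0 : 0 < lam) (h1 : lam < 1) (hx : x ∈ Ioc (0 : ℝ) 1) :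
    ∃ n, 1 ≤ n ∧ x ∈ W lam n := by
  classical
  have hex : ∃ n : ℕ, lam ^ n < x := exists_pow_lt_of_lt_one hx.1 h1
  have hpos : 1 ≤ Nat.find hex := by
    by_contra h
    have h2 := Nat.find_spec hex
    have h3 : Nat.find hex = 0 := by omega
    rw [h3, pow_zero] at h2
    linarith [hx.2]
  exact ⟨Nat.find hex, hpos, Nat.find_spec hex,
    not_lt.1 (Nat.find_min hex (by omega : Nat.find hex - 1 < Nat.find hex))⟩

theorem F_of_mem_W_one {lam x : ℝ} (h0 : 0 < lam) (h1 : lam < 1) (hx : x ∈ W lam 1) :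
    F lam x = (x - lam) / (1 - lam) := by
  rw [F, if_pos (W_subset h0 h1 1 hx), if_pos hx]

theorem F_of_mem_W {lam x : ℝ} (h0 : 0 < lam) (h1 : lam < 1) {n : ℕ} (hn : 2 ≤ n)
    (hx : x ∈ W lam n) : F lam x = (x - lam ^ n) / (lam * (1 - lam)) := by
  have h : x ∉ W lam 1 := fun h => by
    have := index_eq h0 h1 le_rfl h
    rw [index_eq h0 h1 (by omega) hx] at this
    omega
  rw [F, if_pos (W_subset h0 h1 n hx), if_neg h, index_eq h0 h1 (by omega) hx]

theorem mapsTo_F {lam : ℝ} (h0 : 0 < lam) (h1 : lam < 1) :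
    MapsTo (F lam) (Ioc 0 1) (Ioc 0 1) := by
  intro x hx
  obtain ⟨n, hn, hxn⟩ := exists_mem_W h0 h1 hx
  have h1' : 0 < 1 - lam := by linarith
  rcases Nat.lt_or_ge n 2 with h | h
  · obtain rfl : n = 1 := by omega
    rw [F_of_mem_W_one h0 h1 hxn]
    have h2 : lam < x := by simpa using hxn.1
    exact ⟨div_pos (by linarith) h1', (div_le_one h1').2 (by linarith [hx.2])⟩
  · rw [F_of_mem_W h0 h1 h hxn]
    have hd : 0 < lam * (1 - lam) := mul_pos h0 h1'
    refine ⟨div_pos (by linarith [hxn.1]) hd, (div_le_one hd).2 ?_⟩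
    obtain ⟨m, rfl⟩ : ∃ m, n = m + 2 := ⟨n - 2, by omega⟩
    have h3 : x ≤ lam ^ (m + 1) := hxn.2
    have h4 : lam ^ m ≤ 1 := pow_le_one₀ h0.le h1.le
    have h5 : lam ^ (m + 1) - lam ^ (m + 2) = lam ^ m * (lam * (1 - lam)) := by ring
    nlinarith

end PiecewiseLinear

end

/-!
Write `q` for the parameter, `R = q * (1 - q)` and `t = -log 4 / log R`, so that `4 * R ^ t = 1`.
The map `F q` is affine on each interval `W q k`, with slope `1 / R` for `k ≥ 2` and `1 / (1 - q)`
for `k = 1`, and it sends `W q j` onto the union of the `W q k` with `k + 1 ≥ j`. Its orbits are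
therefore coded by the sequences of states that fall by at most one per step.

**Upper bounds.** For `k ≥ 2` the weights `2 ^ (-k)` satisfy `∑_{j ≥ k - 1} 2 ^ (-j) = 4 * 2 ^ (-k)`.
So if `4 * R ^ s < 1`, the sums `∑ diam ^ s` over the cylinders of depth `n` decrease geometrically,
provided that the state `1` is avoided or its ratio satisfies `2 * (1 - q) ^ s < 1`, and that
`(q ^ k) ^ s` is bounded by a multiple of `2 ^ (-k)` for the states `k` in use (`dimH_confined_le`).
Up to the point `0` and countably many affine preimages, escaping points avoid the state `1`, and
`q ^ s ≤ 1 / 2` when `q ≤ 1 / 2` (`dimH_escapingSet_le`). A compact invariant set without `0` meets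
finitely many states, and `2 * (1 - q) ^ s < 1` when `q ≥ 1 / 2` (`hypDim_le`).

**Lower bounds.** They all come from self-similar sets with equal ratios: `N` similarities of ratio
`r` with disjoint images and `N * r ^ s ≥ 1` produce a set of dimension at least `s`
(`exists_selfSimilar_subset`). The similarities are compositions of inverse branches along
itineraries of a fixed length. Loops give sets whose orbits stay away from `0`
(`le_hypDim_of_words`); itineraries that gain levels can be repeated at smaller and smaller scales,
because `F q` commutes with multiplication by `q` on `(0, q]`, and give escaping points
(`le_dimH_escapingSet_of_words`).
* About `4 ^ n` itineraries of length `n` have ratio about `R ^ n` and no or little net gain, whence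
  the bound `t` in both problems (`le_hypDim`, `le_dimH_escapingSet`).
* For `q > 1 / 2` the level has positive drift under Lebesgue measure, so for a suitable positive
  gain the itineraries with that gain have a total length that is not exponentially small, whence
  dimension `1` (`le_dimH_escapingSet_of_lt_one`).
* For `q < 1 / 2` the level is positive recurrent, so the loops at the state `1` have total length
  bounded below. Their ratio depends only on the number of visits to `1`, and the most frequent
  ratio gives dimension `1` (`le_hypDim_of_lt_one`).

At `q = 1 / 2` the value `t` is `1`.
-/

namespace PiecewiseLinear

/-! ### Self-similar sets with equal ratios -/

/-- The limit point `∑ r ^ i * b (ω i)` of the contractions `x ↦ r * x + b i` along `ω`. -/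
noncomputable def limitPoint (r : ℝ) {N : ℕ} (b : Fin N → ℝ) (ω : ℕ → Fin N) : ℝ :=
  ∑' i, r ^ i * b (ω i)

lemma limitPoint_summable {r : ℝ} (hr0 : 0 < r) (hr1 : r < 1) {N : ℕ} (b : Fin N → ℝ)
    (ω : ℕ → Fin N) : Summable fun i => r ^ i * b (ω i) := by
  have h : Summable fun i => r ^ i * ∑ j, |b j| :=
    (summable_geometric_of_lt_one hr0.le hr1).mul_right _
  refine Summable.of_norm_bounded h fun i => ?_
  rw [norm_mul, Real.norm_of_nonneg (by positivity), Real.norm_eq_abs]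
  gcongr
  exact Finset.single_le_sum (f := fun j => |b j|) (fun j _ => abs_nonneg _) (Finset.mem_univ _)

lemma limitPoint_eq {r : ℝ} (hr0 : 0 < r) (hr1 : r < 1) {N : ℕ} (b : Fin N → ℝ)
    (ω : ℕ → Fin N) :
    limitPoint r b ω = b (ω 0) + r * limitPoint r b (fun i => ω (i + 1)) := by
  rw [limitPoint, (limitPoint_summable hr0 hr1 b ω).tsum_eq_zero_add, limitPoint, ← tsum_mul_left]
  simp only [pow_zero, one_mul, pow_succ']
  congr 2
  ext i
  ring

lemma limitPoint_mem {r : ℝ} (hr0 : 0 < r) (hr1 : r < 1) {N : ℕ} {b : Fin N → ℝ} {J : Set ℝ}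
    (hJ : IsCompact J) (hne : J.Nonempty) (hmaps : ∀ i, ∀ x ∈ J, b i + r * x ∈ J)
    (ω : ℕ → Fin N) : limitPoint r b ω ∈ J := by
  obtain ⟨z, hz⟩ := hne
  have hmem : ∀ (n : ℕ) (ω : ℕ → Fin N),
      (∑ i ∈ Finset.range n, r ^ i * b (ω i)) + r ^ n * z ∈ J := by
    intro n
    induction n with
    | zero => intro ω; simpa using hz
    | succ n ih =>
      intro ω
      convert hmaps (ω 0) _ (ih fun i => ω (i + 1)) using 1
      rw [Finset.sum_range_succ', mul_add, Finset.mul_sum]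
      simp only [pow_succ', mul_assoc, pow_zero, one_mul]
      ring
  refine hJ.isClosed.mem_of_tendsto (b := atTop) ?_ (Eventually.of_forall fun n => hmem n ω)
  have h1 := (limitPoint_summable hr0 hr1 b ω).hasSum.tendsto_sum_nat
  have h2 := (tendsto_pow_atTop_nhds_zero_of_lt_one hr0.le hr1).mul_const z
  simpa [limitPoint] using h1.add h2

lemma exists_separation {r : ℝ} {N : ℕ} {b : Fin N → ℝ} {J : Set ℝ} (hJ : IsCompact J)
    (hdisj : ∀ i j, i ≠ j → ∀ x ∈ J, ∀ y ∈ J, b i + r * x ≠ b j + r * y) :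
    ∃ δ > 0, ∀ i j, i ≠ j → ∀ x ∈ J, ∀ y ∈ J, δ ≤ |(b i + r * x) - (b j + r * y)| := by
  have hpair : ∀ i j, ∃ δ > 0, i ≠ j → ∀ x ∈ J, ∀ y ∈ J,
      δ ≤ |(b i + r * x) - (b j + r * y)| := by
    intro i j
    by_cases hij : i = j
    · exact ⟨1, one_pos, fun h => absurd hij h⟩
    rcases J.eq_empty_or_nonempty with rfl | hne
    · exact ⟨1, one_pos, by simp⟩
    obtain ⟨p, hp, hmin⟩ := (hJ.prod hJ).exists_isMinOn (hne.prod hne)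
      (f := fun p : ℝ × ℝ => |(b i + r * p.1) - (b j + r * p.2)|) (by fun_prop)
    refine ⟨_, abs_pos.2 (sub_ne_zero.2 (hdisj i j hij p.1 hp.1 p.2 hp.2)), ?_⟩
    exact fun _ x hx y hy => isMinOn_iff.1 hmin (x, y) ⟨hx, hy⟩
  choose δ hδ hsep using hpair
  have h1 : ∀ᶠ ε in 𝓝[>] (0 : ℝ), ∀ i j, ε < δ i j :=
    eventually_all.2 fun i => eventually_all.2 fun j =>
      (eventually_lt_nhds (hδ i j)).filter_mono nhdsWithin_le_nhds
  obtain ⟨ε, hε, hpos⟩ := (h1.and self_mem_nhdsWithin).exists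
  exact ⟨ε, hpos, fun i j hij x hx y hy => (hε i j).le.trans (hsep i j hij x hx y hy)⟩

/-- The dimension of a self-similar set with `N` disjoint pieces of the same ratio `r`. The map that
reads the code of a point as a base `N` expansion is Hölder of exponent `s` and sends the set onto
`[0, 1]`. -/
theorem exists_selfSimilar_subset {r : ℝ} (hr0 : 0 < r) (hr1 : r < 1) {N : ℕ} {b : Fin N → ℝ}
    {J : Set ℝ} (hJ : IsCompact J) (hne : J.Nonempty)
    (hmaps : ∀ i, ∀ x ∈ J, b i + r * x ∈ J)
    (hdisj : ∀ i j, i ≠ j → ∀ x ∈ J, ∀ y ∈ J, b i + r * x ≠ b j + r * y)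
    {s : ℝ} (hs : 0 < s) (hN : 1 ≤ N * r ^ s) :
    ∃ E ⊆ J, ENNReal.ofReal s ≤ dimH E ∧ ∀ x ∈ E, ∃ i, ∃ y ∈ E, x = b i + r * y := by
  have hN1 : 1 < N := by
    have h1 : r ^ s < 1 := Real.rpow_lt_one hr0.le hr1 hs
    have h2 : 0 < r ^ s := Real.rpow_pos_of_pos hr0 s
    by_contra h
    have h3 : (N : ℝ) ≤ 1 := by exact_mod_cast not_lt.1 h
    nlinarith
  obtain ⟨δ, hδ, hsep⟩ := exists_separation hJ hdisj
  have hmem := limitPoint_mem hr0 hr1 hJ hne hmaps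
  -- two codes that first differ at place `m` have limit points at distance at least `r ^ m * δ`
  have hdist : ∀ (m : ℕ) (ω ω' : ℕ → Fin N), (∀ i < m, ω i = ω' i) → ω m ≠ ω' m →
      r ^ m * δ ≤ |limitPoint r b ω - limitPoint r b ω'| := by
    intro m
    induction m with
    | zero =>
      intro ω ω' _ hne
      rw [limitPoint_eq hr0 hr1 b ω, limitPoint_eq hr0 hr1 b ω', pow_zero, one_mul]
      exact hsep _ _ hne _ (hmem _) _ (hmem _)
    | succ m ih =>
      intro ω ω' heq hne
      have h := ih (fun i => ω (i + 1)) (fun i => ω' (i + 1))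
        (fun i hi => heq _ (by omega)) hne
      rw [limitPoint_eq hr0 hr1 b ω, limitPoint_eq hr0 hr1 b ω', heq 0 (by omega),
        add_sub_add_left_eq_sub, ← mul_sub, abs_mul, abs_of_pos hr0, pow_succ', mul_assoc]
      gcongr
  have hholder : ∀ ω ω' : ℕ → Fin N, |Real.ofDigits ω - Real.ofDigits ω'| ≤
      δ ^ (-s) * |limitPoint r b ω - limitPoint r b ω'| ^ s := by
    intro ω ω'
    by_cases h : ω = ω'
    · subst h
      simp [Real.zero_rpow hs.ne']
    · classical
      have hex : ∃ m, ω m ≠ ω' m := Function.ne_iff.1 h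
      have hlt : ∀ i < Nat.find hex, ω i = ω' i := fun i hi => not_not.1 (Nat.find_min hex hi)
      have h1 := hdist _ ω ω' hlt (Nat.find_spec hex)
      set m := Nat.find hex
      have hrs : 0 < r ^ s := Real.rpow_pos_of_pos hr0 s
      calc |Real.ofDigits ω - Real.ofDigits ω'| ≤ ((N : ℝ) ^ m)⁻¹ :=
            Real.abs_ofDigits_sub_ofDigits_le hlt
        _ ≤ (r ^ s) ^ m := by
            rw [← inv_pow]
            gcongr
            rw [inv_le_iff_one_le_mul₀ (by positivity), mul_comm]
            exact hN
        _ = δ ^ (-s) * (r ^ m * δ) ^ s := by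
            rw [Real.mul_rpow (by positivity) hδ.le, Real.rpow_neg hδ.le, ← Real.rpow_natCast,
              ← Real.rpow_natCast, ← Real.rpow_mul hr0.le, ← Real.rpow_mul hr0.le, mul_comm s]
            have : δ ^ s ≠ 0 := (Real.rpow_pos_of_pos hδ s).ne'
            field_simp
        _ ≤ _ := by gcongr
  let E := range (limitPoint r b)
  refine ⟨E, ?_, ?_, ?_⟩
  · rintro _ ⟨ω, rfl⟩
    exact hmem ω
  · have : Nonempty (Fin N) := ⟨⟨0, by omega⟩⟩
    have hinv : ∀ x ∈ E, ∃ ω, limitPoint r b ω = x := fun x hx => hx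
    choose! code hcode using hinv
    let g : ℝ → ℝ := fun x => Real.ofDigits (code x)
    have hg : ∀ ω, g (limitPoint r b ω) = Real.ofDigits ω := by
      intro ω
      have h1 := hholder (code (limitPoint r b ω)) ω
      rw [hcode _ ⟨ω, rfl⟩, sub_self, abs_zero, Real.zero_rpow hs.ne', mul_zero] at h1
      exact sub_eq_zero.1 (abs_nonpos_iff.1 h1)
    have hH : HolderOnWith (Real.toNNReal (δ ^ (-s))) (Real.toNNReal s) g E := by
      rintro _ ⟨ω, rfl⟩ _ ⟨ω', rfl⟩
      rw [hg, hg, edist_dist, edist_dist, Real.dist_eq, Real.dist_eq,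
        Real.coe_toNNReal _ hs.le, ENNReal.ofReal_rpow_of_nonneg (abs_nonneg _) hs.le]
      change _ ≤ ENNReal.ofReal _ * _
      rw [← ENNReal.ofReal_mul (by positivity)]
      exact ENNReal.ofReal_le_ofReal (hholder ω ω')
    have himg : Icc (0 : ℝ) 1 ⊆ g '' E := by
      intro y hy
      obtain ⟨ω, -, rfl⟩ := Real.ofDigits_SurjOn hN1 hy
      exact ⟨_, ⟨ω, rfl⟩, hg ω⟩
    have h1 : (1 : ENNReal) ≤ dimH (g '' E) := by
      have h2 : dimH (Icc (0 : ℝ) 1) = 1 := by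
        rw [Real.dimH_of_nonempty_interior (by simp)]
        simp
      exact h2 ▸ dimH_mono himg
    have h3 := h1.trans (hH.dimH_image_le (Real.toNNReal_pos.2 hs))
    have h4 : ((Real.toNNReal s : NNReal) : ENNReal) ≠ 0 := by simpa using hs
    rw [ENNReal.le_div_iff_mul_le (Or.inl h4) (Or.inl ENNReal.coe_ne_top), one_mul] at h3
    exact h3
  · rintro _ ⟨ω, rfl⟩
    exact ⟨ω 0, _, ⟨fun i => ω (i + 1), rfl⟩, limitPoint_eq hr0 hr1 b ω⟩

/-! ### Inverse branches and itineraries -/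

/-- The contraction ratio of the inverse branch of `F q` with values in `W q k`. -/
noncomputable def ratio (q : ℝ) (k : ℕ) : ℝ := if k = 1 then 1 - q else q * (1 - q)

/-- The inverse branch of `F q` with values in `W q k`. -/
noncomputable def branch (q : ℝ) (k : ℕ) (y : ℝ) : ℝ := q ^ k + ratio q k * y

/-- The composition of inverse branches along a finite itinerary. The list of states is read
backwards in time: its head is the last state visited, so that it is applied first. -/
noncomputable def branchComp (q : ℝ) : List ℕ → ℝ → ℝ
  | [], y => y
  | j :: l, y => branchComp q l (branch q j y)

/-- The itineraries of length `n` from the state `k₀` to the state `k`: lists of the `n` states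
before `k`, latest first. A step from `j ≥ 1` may lead to `k ≥ 1` exactly when
`W q k ⊆ F q '' W q j`, that is, when `j ≤ k + 1`. -/
def words (k₀ : ℕ) : ℕ → ℕ → Finset (List ℕ)
  | 0, k => if k = k₀ then {[]} else ∅
  | n + 1, k => (Finset.Icc 1 (k + 1)).biUnion fun j => (words k₀ n j).image (List.cons j)

lemma mem_words_zero {k₀ k : ℕ} {l : List ℕ} : l ∈ words k₀ 0 k ↔ k = k₀ ∧ l = [] := by
  rw [words]
  split_ifs with h <;> simp [h]

lemma mem_words_succ {k₀ n k : ℕ} {l : List ℕ} :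
    l ∈ words k₀ (n + 1) k ↔ ∃ j l', 1 ≤ j ∧ j ≤ k + 1 ∧ l' ∈ words k₀ n j ∧ l = j :: l' := by
  simp only [words, Finset.mem_biUnion, Finset.mem_Icc, Finset.mem_image]
  constructor
  · rintro ⟨j, ⟨h1, h2⟩, l', hl', rfl⟩
    exact ⟨j, l', h1, h2, hl', rfl⟩
  · rintro ⟨j, l', h1, h2, hl', rfl⟩
    exact ⟨j, ⟨h1, h2⟩, l', hl', rfl⟩

lemma sum_words_succ {M : Type*} [AddCommMonoid M] (k₀ n k : ℕ) (f : List ℕ → M) :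
    ∑ l ∈ words k₀ (n + 1) k, f l =
      ∑ j ∈ Finset.Icc 1 (k + 1), ∑ l ∈ words k₀ n j, f (j :: l) := by
  rw [words, Finset.sum_biUnion]
  · refine Finset.sum_congr rfl fun j _ => Finset.sum_image ?_
    intro a _ b _ h
    exact (List.cons.inj h).2
  · intro i _ j _ hij
    refine Finset.disjoint_left.2 fun l hi hj => hij ?_
    obtain ⟨a, -, rfl⟩ := Finset.mem_image.1 hi
    obtain ⟨b, -, hb⟩ := Finset.mem_image.1 hj
    exact ((List.cons.inj hb).1).symm

lemma length_of_mem_words {k₀ : ℕ} : ∀ {n k : ℕ} {l : List ℕ}, l ∈ words k₀ n k → l.length = n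
  | 0, _, _, h => by rw [(mem_words_zero.1 h).2]; rfl
  | n + 1, _, _, h => by
    obtain ⟨j, l', -, -, hl', rfl⟩ := mem_words_succ.1 h
    rw [List.length_cons, length_of_mem_words hl']

/-- States decrease by at most one per step. -/
lemma le_add_of_mem_words {k₀ : ℕ} : ∀ {n k : ℕ} {l : List ℕ}, l ∈ words k₀ n k → k₀ ≤ k + n
  | 0, _, _, h => by rw [(mem_words_zero.1 h).1]; omega
  | n + 1, k, _, h => by
    obtain ⟨j, l', -, h2, hl', rfl⟩ := mem_words_succ.1 h
    have := le_add_of_mem_words hl'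
    omega

section Branches

variable {q : ℝ} (h0 : 0 < q) (h1 : q < 1)
include h0 h1

lemma ratio_pos (k : ℕ) : 0 < ratio q k := by
  have : 0 < 1 - q := by linarith
  rw [ratio]
  split_ifs
  · exact this
  · positivity

omit h0 in
lemma ratio_le (k : ℕ) : ratio q k ≤ 1 - q := by
  rw [ratio]
  split_ifs
  · exact le_rfl
  · nlinarith

omit h0 in
lemma le_ratio (k : ℕ) : q * (1 - q) ≤ ratio q k := by
  rw [ratio]
  split_ifs
  · nlinarith
  · exact le_rfl

lemma branch_F {k : ℕ} (hk : 1 ≤ k) {x : ℝ} (hx : x ∈ W q k) : branch q k (F q x) = x := by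
  have hq : 0 < 1 - q := by linarith
  rcases Nat.lt_or_ge k 2 with h | h
  · obtain rfl : k = 1 := by omega
    rw [F_of_mem_W_one h0 h1 hx, branch, ratio, if_pos rfl]
    field_simp
    ring
  · rw [F_of_mem_W h0 h1 h hx, branch, ratio, if_neg (by omega)]
    field_simp
    ring

lemma branch_mem {j k : ℕ} (hj : 1 ≤ j) (hjk : j ≤ k + 1) {y : ℝ} (hy : y ∈ W q k) :
    branch q j y ∈ W q j := by
  have hq : 0 < 1 - q := by linarith
  have hy0 : 0 < y := (W_subset h0 h1 k hy).1
  refine ⟨?_, ?_⟩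
  · have := mul_pos (ratio_pos h0 h1 j) hy0
    rw [branch]
    linarith
  · rcases Nat.lt_or_ge j 2 with h | h
    · obtain rfl : j = 1 := by omega
      have := (W_subset h0 h1 k hy).2
      simp only [branch, ratio, if_pos, pow_one, Nat.sub_self, pow_zero]
      nlinarith
    · obtain ⟨m, rfl⟩ : ∃ m, j = m + 2 := ⟨j - 2, by omega⟩
      have hle : y ≤ q ^ m := hy.2.trans (pow_le_pow_of_le_one h0.le h1.le (by omega))
      have h2 : q * (1 - q) * y ≤ q * (1 - q) * q ^ m := by gcongr
      rw [branch, ratio, if_neg (by omega), show m + 2 - 1 = m + 1 by omega]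
      have h3 : q ^ (m + 2) + q * (1 - q) * q ^ m = q ^ (m + 1) := by ring
      linarith

lemma F_branch {j k : ℕ} (hj : 1 ≤ j) (hjk : j ≤ k + 1) {y : ℝ} (hy : y ∈ W q k) :
    F q (branch q j y) = y := by
  have h := branch_F h0 h1 hj (branch_mem h0 h1 hj hjk hy)
  rw [branch, branch] at h
  exact mul_left_cancel₀ (ratio_pos h0 h1 j).ne' (add_left_cancel h)

lemma branchComp_mem {k₀ : ℕ} : ∀ {n k : ℕ} {l : List ℕ} {y : ℝ}, l ∈ words k₀ n k →
    y ∈ W q k → branchComp q l y ∈ W q k₀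
  | 0, _, _, _, hl, hy => by
    obtain ⟨rfl, rfl⟩ := mem_words_zero.1 hl
    exact hy
  | n + 1, _, _, _, hl, hy => by
    obtain ⟨j, l', hj, hjk, hl', rfl⟩ := mem_words_succ.1 hl
    have hb := branch_mem h0 h1 hj hjk hy
    exact (branchComp_mem hl' hb :)

lemma iterate_branchComp {k₀ : ℕ} : ∀ {n k : ℕ} {l : List ℕ} {y : ℝ}, l ∈ words k₀ n k →
    y ∈ W q k → (F q)^[n] (branchComp q l y) = y
  | 0, _, _, _, hl, hy => by
    obtain ⟨rfl, rfl⟩ := mem_words_zero.1 hl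
    rfl
  | n + 1, _, _, _, hl, hy => by
    obtain ⟨j, l', hj, hjk, hl', rfl⟩ := mem_words_succ.1 hl
    rw [Function.iterate_succ_apply', branchComp,
      iterate_branchComp hl' (branch_mem h0 h1 hj hjk hy), F_branch h0 h1 hj hjk hy]

/-- A property of states that holds along the itinerary locates the orbit. -/
lemma iterate_branchComp_mem {k₀ : ℕ} {P : ℕ → Prop} : ∀ {n k : ℕ} {l : List ℕ} {y : ℝ},
    l ∈ words k₀ n k → y ∈ W q k → (∀ j ∈ l, P j) → ∀ i < n,
      ∃ j, P j ∧ (F q)^[i] (branchComp q l y) ∈ W q j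
  | 0, _, _, _, _, _, _, i, hi => by omega
  | n + 1, _, _, y, hl, hy, hP, i, hi => by
    obtain ⟨j, l', hj, hjk, hl', rfl⟩ := mem_words_succ.1 hl
    have hb := branch_mem h0 h1 hj hjk hy
    rcases Nat.lt_succ_iff_lt_or_eq.1 hi with h | rfl
    · exact iterate_branchComp_mem hl' hb (fun j hj => hP j (by simp [hj])) i h
    · refine ⟨j, hP j (by simp), ?_⟩
      rw [branchComp, iterate_branchComp h0 h1 hl' hb]
      exact hb

/-- An itinerary is determined by any point that follows it. -/
lemma branchComp_inj {k₀ : ℕ} : ∀ {n k : ℕ} {l l' : List ℕ} {y y' : ℝ}, l ∈ words k₀ n k →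
    l' ∈ words k₀ n k → y ∈ W q k → y' ∈ W q k →
    branchComp q l y = branchComp q l' y' → l = l'
  | 0, _, _, _, _, _, hl, hl', _, _, _ => by
    rw [(mem_words_zero.1 hl).2, (mem_words_zero.1 hl').2]
  | n + 1, k, _, _, y, y', hl, hl', hy, hy', h => by
    obtain ⟨j, m, hj, hjk, hm, rfl⟩ := mem_words_succ.1 hl
    obtain ⟨j', m', hj', hjk', hm', rfl⟩ := mem_words_succ.1 hl'
    have hb := branch_mem h0 h1 hj hjk hy
    have hb' := branch_mem h0 h1 hj' hjk' hy'
    rw [branchComp, branchComp] at h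
    have hbb : branch q j y = branch q j' y' := by
      rw [← iterate_branchComp h0 h1 hm hb, h, iterate_branchComp h0 h1 hm' hb']
    obtain rfl : j = j' := by
      rw [← index_eq h0 h1 hj hb, ← index_eq h0 h1 hj' hb', hbb]
    rw [branchComp_inj hm hm' hb hb' h]

omit h0 h1 in
lemma branchComp_eq (q : ℝ) : ∀ (l : List ℕ) (y : ℝ),
    branchComp q l y = branchComp q l 0 + (l.map (ratio q)).prod * y
  | [], y => by simp [branchComp]
  | j :: l, y => by
    rw [branchComp, branchComp, branchComp_eq q l (branch q j y), branchComp_eq q l (branch q j 0)]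
    simp only [branch, List.map_cons, List.prod_cons]
    ring

lemma prod_ratio_pos (l : List ℕ) : 0 < (l.map (ratio q)).prod :=
  List.prod_pos fun a ha => by
    obtain ⟨k, -, rfl⟩ := List.mem_map.1 ha
    exact ratio_pos h0 h1 k

lemma prod_ratio_le (l : List ℕ) : (l.map (ratio q)).prod ≤ (1 - q) ^ l.length := by
  induction l with
  | nil => simp
  | cons j l ih =>
    rw [List.map_cons, List.prod_cons, List.length_cons, pow_succ']
    exact mul_le_mul (ratio_le h1 j) ih (prod_ratio_pos h0 h1 l).le (by linarith)

lemma le_branchComp_zero {k₀ : ℕ} : ∀ {n k : ℕ} {l : List ℕ}, l ∈ words k₀ (n + 1) k →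
    q ^ k₀ ≤ branchComp q l 0
  | 0, _, _, hl => by
    obtain ⟨j, m, -, -, hm, rfl⟩ := mem_words_succ.1 hl
    obtain ⟨rfl, rfl⟩ := mem_words_zero.1 hm
    simp [branchComp, branch]
  | n + 1, _, _, hl => by
    obtain ⟨j, m, -, -, hm, rfl⟩ := mem_words_succ.1 hl
    refine (le_branchComp_zero hm).trans ?_
    have h2 : 0 ≤ branch q j 0 := by simpa [branch] using (pow_pos h0 j).le
    rw [branchComp, branchComp_eq q m (branch q j 0)]
    exact le_add_of_nonneg_right (mul_nonneg (prod_ratio_pos h0 h1 m).le h2)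

omit h1 in
lemma pow_mul_mem_W {k : ℕ} (hk : 1 ≤ k) (J : ℕ) {y : ℝ} (hy : y ∈ W q k) :
    q ^ J * y ∈ W q (k + J) := by
  have hJ : 0 < q ^ J := pow_pos h0 J
  refine ⟨?_, ?_⟩
  · rw [pow_add, mul_comm]
    exact mul_lt_mul_of_pos_left hy.1 hJ
  · rw [show k + J - 1 = J + (k - 1) by omega, pow_add]
    exact mul_le_mul_of_nonneg_left hy.2 hJ.le

/-- A set `S` of itineraries from `k₀` to `k₀ + J` with a common contraction ratio `ρ` yields a
self-similar subset of `W q k₀`: each itinerary is followed by the change of scale by `q ^ J`, which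
carries `W q k₀` onto `W q (k₀ + J)`. -/
theorem exists_cantor {k₀ n J : ℕ} (hk₀ : 1 ≤ k₀) {S : Finset (List ℕ)}
    (hS : S ⊆ words k₀ (n + 1) (k₀ + J)) {ρ : ℝ} (hρ : ∀ l ∈ S, (l.map (ratio q)).prod = ρ)
    {s : ℝ} (hs : 0 < s) (hcard : 1 ≤ S.card * (ρ * q ^ J) ^ s) :
    ∃ E ⊆ W q k₀, ENNReal.ofReal s ≤ dimH E ∧
      ∀ x ∈ E, ∃ l ∈ S, ∃ y ∈ E, x = branchComp q l (q ^ J * y) := by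
  have hJ : 0 < q ^ J := pow_pos h0 J
  have hJ1 : q ^ J ≤ 1 := pow_le_one₀ h0.le h1.le
  obtain ⟨l₀, hl₀⟩ : S.Nonempty := by
    rw [Finset.nonempty_iff_ne_empty]
    rintro rfl
    norm_num at hcard
  have hρ0 : 0 < ρ := hρ l₀ hl₀ ▸ prod_ratio_pos h0 h1 l₀
  have hρ1 : ρ < 1 := by
    rw [← hρ l₀ hl₀]
    refine (prod_ratio_le h0 h1 l₀).trans_lt ?_
    rw [length_of_mem_words (hS hl₀)]
    exact pow_lt_one₀ (by linarith) (by linarith) (by omega)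
  -- away from the open end point of `W q k₀` there is a compact interval invariant under all maps
  let K : Set ℝ := Icc (q ^ k₀ + ρ * q ^ J * q ^ k₀) (q ^ (k₀ - 1))
  have hKW : K ⊆ W q k₀ := fun x hx =>
    ⟨lt_of_lt_of_le (lt_add_of_pos_right _ (by positivity)) hx.1, hx.2⟩
  have heq : ∀ l ∈ S, ∀ x, branchComp q l 0 + ρ * q ^ J * x = branchComp q l (q ^ J * x) := by
    intro l hl x
    rw [branchComp_eq q l (q ^ J * x), hρ l hl]
    ring
  have hmapsW : ∀ l ∈ S, ∀ x ∈ W q k₀, branchComp q l 0 + ρ * q ^ J * x ∈ K := by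
    intro l hl x hx
    refine ⟨?_, ?_⟩
    · have h2 := le_branchComp_zero h0 h1 (hS hl)
      have h3 : ρ * q ^ J * q ^ k₀ ≤ ρ * q ^ J * x := by
        gcongr
        exact hx.1.le
      linarith
    · rw [heq l hl]
      exact (branchComp_mem h0 h1 (hS hl) (pow_mul_mem_W h0 hk₀ J hx)).2
  have hright : q ^ (k₀ - 1) ∈ W q k₀ :=
    ⟨pow_lt_pow_right_of_lt_one₀ h0 h1 (by omega), le_rfl⟩
  let e := S.equivFin
  obtain ⟨E, hEK, hdim, hE⟩ := exists_selfSimilar_subset (r := ρ * q ^ J) (by positivity)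
    (lt_of_le_of_lt (mul_le_of_le_one_right hρ0.le hJ1) hρ1)
    (b := fun i => branchComp q (e.symm i : List ℕ) 0) (J := K) isCompact_Icc
    ⟨_, hmapsW l₀ hl₀ _ hright⟩
    (fun i x hx => hmapsW _ (e.symm i).2 x (hKW hx))
    (fun i j hij x hx y hy h => hij <| e.symm.injective <| Subtype.ext <| by
      rw [heq _ (e.symm i).2, heq _ (e.symm j).2] at h
      exact branchComp_inj h0 h1 (hS (e.symm i).2) (hS (e.symm j).2)
        (pow_mul_mem_W h0 hk₀ J (hKW hx)) (pow_mul_mem_W h0 hk₀ J (hKW hy)) h)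
    hs hcard
  refine ⟨E, hEK.trans hKW, hdim, fun x hx => ?_⟩
  obtain ⟨i, y, hy, rfl⟩ := hE x hx
  exact ⟨_, (e.symm i).2, y, hy, heq _ (e.symm i).2 y⟩

end Branches

/-! ### Orbits of the self-similar sets -/

section Orbits

variable {q : ℝ} (h0 : 0 < q) (h1 : q < 1)
include h0 h1

lemma iterate_mem_Ioc {x : ℝ} (hx : x ∈ Ioc (0 : ℝ) 1) (i : ℕ) : (F q)^[i] x ∈ Ioc (0 : ℝ) 1 :=
  (mapsTo_F h0 h1).iterate i hx

/-- The points of `(0, 1]` whose orbit stays above `q ^ M`. These sets are compact and invariant,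
and exhaust the invariant sets that count for the hyperbolic dimension. -/
def trapped (q : ℝ) (M : ℕ) : Set ℝ := {x ∈ Ioc (0 : ℝ) 1 | ∀ i, q ^ M < (F q)^[i] x}

/-- The points of `[q ^ M + δ, 1]` not in the gaps `(q ^ k, q ^ k + δ)`. The discontinuities of
`F q` on `(0, ∞)` are the points `q ^ k`, and `F q` is left continuous there; removing the gaps
makes `F q` continuous on what remains. -/
def gapped (q : ℝ) (M : ℕ) (δ : ℝ) : Set ℝ :=
  Icc (q ^ M + δ) 1 ∩ ⋂ k : ℕ, (Ioo (q ^ k) (q ^ k + δ))ᶜ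

omit h0 h1 in
lemma isClosed_gapped (M : ℕ) (δ : ℝ) : IsClosed (gapped q M δ) :=
  isClosed_Icc.inter (isClosed_iInter fun _ => isOpen_Ioo.isClosed_compl)

lemma continuousOn_gapped (M : ℕ) {δ : ℝ} (hδ : 0 < δ) : ContinuousOn (F q) (gapped q M δ) := by
  intro x hx
  have hx01 : x ∈ Ioc (0 : ℝ) 1 :=
    ⟨lt_of_lt_of_le (by positivity) hx.1.1, hx.1.2⟩
  obtain ⟨k, hk, hxk⟩ := exists_mem_W h0 h1 hx01
  have haff : ∀ y ∈ W q k, F q y = (y - q ^ k) / ratio q k := by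
    intro y hy
    have h2 := branch_F h0 h1 hk hy
    rw [branch] at h2
    rw [eq_div_iff (ratio_pos h0 h1 k).ne']
    linarith
  have hnhds : Ioo (q ^ k) (q ^ (k - 1) + δ) ∈ 𝓝 x :=
    Ioo_mem_nhds hxk.1 (hxk.2.trans_lt (by linarith))
  have hEq : F q =ᶠ[𝓝[gapped q M δ] x] fun y => (y - q ^ k) / ratio q k := by
    filter_upwards [mem_nhdsWithin_of_mem_nhds hnhds, self_mem_nhdsWithin] with y hy hyT
    refine haff y ⟨hy.1, not_lt.1 fun h => ?_⟩
    exact mem_iInter.1 hyT.2 (k - 1) ⟨h, hy.2⟩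
  have hc : Continuous fun y : ℝ => (y - q ^ k) / ratio q k := by fun_prop
  exact hc.continuousWithinAt.congr_of_eventuallyEq hEq (haff x hxk)

omit h0 h1 in
lemma isClosed_iterate_mem {X : Type*} [TopologicalSpace X] {f : X → X} {T : Set X}
    (hT : IsClosed T) (hf : ContinuousOn f T) : IsClosed {x | ∀ i, f^[i] x ∈ T} := by
  have hfin : ∀ n : ℕ, IsClosed {x | ∀ i ≤ n, f^[i] x ∈ T} := by
    intro n
    induction n with
    | zero => simpa using hT
    | succ n ih =>
      convert hf.preimage_isClosed_of_isClosed hT ih using 1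
      ext x
      simp only [mem_ofPred_eq, mem_inter_iff, mem_preimage]
      constructor
      · intro h
        exact ⟨h 0 (by omega), fun i hi => h (i + 1) (by omega)⟩
      · rintro ⟨h2, h3⟩ i hi
        cases i with
        | zero => exact h2
        | succ i => exact h3 i (by omega)
  convert isClosed_iInter hfin using 1
  ext x
  simp only [mem_ofPred_eq, mem_iInter]
  exact ⟨fun h _ i _ => h i, fun h i => h i i le_rfl⟩

lemma mem_gapped {M : ℕ} {x : ℝ} (hx : x ∈ Ioc (0 : ℝ) 1) (hM : q ^ M < x) (hM' : q ^ M < F q x) :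
    x ∈ gapped q M (q * (1 - q) * q ^ M) := by
  obtain ⟨k, hk, hxk⟩ := exists_mem_W h0 h1 hx
  have h2 := branch_F h0 h1 hk hxk
  have h3 : q * (1 - q) * q ^ M ≤ ratio q k * F q x :=
    mul_le_mul (le_ratio h1 k) hM'.le (by positivity) (ratio_pos h0 h1 k).le
  have h4 : q ^ k + q * (1 - q) * q ^ M ≤ x := by
    rw [branch] at h2
    linarith
  have hkM : k ≤ M := by
    by_contra h
    have := pow_le_pow_of_le_one h0.le h1.le (show M ≤ k - 1 by omega)
    linarith [hxk.2]
  refine ⟨⟨?_, hx.2⟩, mem_iInter.2 fun j hj => ?_⟩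
  · have := pow_le_pow_of_le_one h0.le h1.le hkM
    linarith
  · rcases Nat.lt_or_ge j k with h | h
    · have := pow_le_pow_of_le_one h0.le h1.le (show j ≤ k - 1 by omega)
      linarith [hxk.2, hj.1]
    · have := pow_le_pow_of_le_one h0.le h1.le h
      linarith [hj.2]

/-- The set `trapped q M` is closed because `F q` is continuous on a closed set that contains all
its orbits: a point of `W q k` with image above `q ^ M` lies at distance at least
`q * (1 - q) * q ^ M` from the left end point of `W q k`. -/
lemma isCompact_trapped (M : ℕ) : IsCompact (trapped q M) := by
  have hδ : 0 < q * (1 - q) * q ^ M := by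
    have : 0 < 1 - q := by linarith
    positivity
  have heq : trapped q M = {x | ∀ i, (F q)^[i] x ∈ gapped q M (q * (1 - q) * q ^ M)} := by
    ext x
    constructor
    · intro hx i
      refine mem_gapped h0 h1 (iterate_mem_Ioc h0 h1 hx.1 i) (hx.2 i) ?_
      have h3 := hx.2 (i + 1)
      rwa [Function.iterate_succ_apply'] at h3
    · intro hx
      refine ⟨⟨?_, (hx 0).1.2⟩, fun i => ?_⟩
      · exact lt_of_lt_of_le (by positivity) (hx 0).1.1
      · exact lt_of_lt_of_le (by linarith) (hx i).1.1
  refine isCompact_Icc.of_isClosed_subset ?_ (fun x hx => Ioc_subset_Icc_self hx.1)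
  rw [heq]
  exact isClosed_iterate_mem (isClosed_gapped M _) (continuousOn_gapped h0 h1 M hδ)

lemma dimH_trapped_le_hypDim (M : ℕ) : dimH (trapped q M) ≤ hypDim q := by
  refine le_iSup₂_of_le (trapped q M) ⟨fun x hx => Ioc_subset_Icc_self hx.1,
    isCompact_trapped h0 h1 M, fun x hx => ⟨mapsTo_F h0 h1 hx.1, fun i => ?_⟩,
    fun h => lt_irrefl _ h.1.1⟩ le_rfl
  rw [← Function.iterate_succ_apply]
  exact hx.2 (i + 1)

/-- Loops with a common contraction ratio bound the hyperbolic dimension from below. -/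
theorem le_hypDim_of_words {k₀ n : ℕ} (hk₀ : 1 ≤ k₀) {S : Finset (List ℕ)}
    (hS : S ⊆ words k₀ (n + 1) k₀) {ρ : ℝ} (hρ : ∀ l ∈ S, (l.map (ratio q)).prod = ρ)
    {s : ℝ} (hs : 0 < s) (hcard : 1 ≤ S.card * ρ ^ s) : ENNReal.ofReal s ≤ hypDim q := by
  obtain ⟨E, hEW, hdim, hE⟩ := exists_cantor h0 h1 (J := 0) hk₀ hS hρ hs (by simpa using hcard)
  let M := ∑ l ∈ S, l.sum
  have hM : ∀ l ∈ S, ∀ j ∈ l, j ≤ M := fun l hl j hj =>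
    (List.le_sum_of_mem hj).trans
      (Finset.single_le_sum (f := List.sum) (fun _ _ => Nat.zero_le _) hl)
  have hsub : E ⊆ trapped q M := by
    refine fun x hx => ⟨W_subset h0 h1 k₀ (hEW hx), fun i => ?_⟩
    induction i using Nat.strong_induction_on generalizing x with
    | _ i ih =>
      obtain ⟨l, hl, y, hy, rfl⟩ := hE x hx
      rw [pow_zero, one_mul]
      rcases Nat.lt_or_ge i (n + 1) with h | h
      · obtain ⟨j, hj, hmem⟩ := iterate_branchComp_mem h0 h1 (hS hl) (hEW hy) (hM l hl) i h
        exact (pow_le_pow_of_le_one h0.le h1.le hj).trans_lt hmem.1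
      · obtain ⟨a, rfl⟩ := Nat.exists_eq_add_of_le' h
        rw [Function.iterate_add_apply, iterate_branchComp h0 h1 (hS hl) (hEW hy)]
        exact ih a (by omega) y hy
  exact hdim.trans ((dimH_mono hsub).trans (dimH_trapped_le_hypDim h0 h1 M))

lemma F_pow_mul (a : ℕ) {x : ℝ} (hx0 : 0 < x) (hxq : x ≤ q) : F q (q ^ a * x) = q ^ a * F q x := by
  obtain ⟨k, hk, hxk⟩ := exists_mem_W h0 h1 ⟨hx0, hxq.trans h1.le⟩
  have hk2 : 2 ≤ k := by
    by_contra h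
    obtain rfl : k = 1 := by omega
    have := hxk.1
    rw [pow_one] at this
    linarith
  rw [F_of_mem_W h0 h1 hk2 hxk, F_of_mem_W h0 h1 (by omega) (pow_mul_mem_W h0 hk a hxk), pow_add]
  ring

lemma iterate_pow_mul (a : ℕ) {x : ℝ} (hx : x ∈ Ioc (0 : ℝ) 1) : ∀ n : ℕ,
    (∀ i < n, (F q)^[i] x ≤ q) → (F q)^[n] (q ^ a * x) = q ^ a * (F q)^[n] x
  | 0, _ => rfl
  | n + 1, h => by
    rw [Function.iterate_succ_apply', Function.iterate_succ_apply',
      iterate_pow_mul a hx n fun i hi => h i (by omega),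
      F_pow_mul h0 h1 a (iterate_mem_Ioc h0 h1 hx n).1 (h n (by omega))]

lemma F_le {x : ℝ} (hx : x ∈ Ioc (0 : ℝ) 1) : F q x ≤ (q * (1 - q))⁻¹ * x := by
  have hq : 0 < q * (1 - q) := mul_pos h0 (by linarith)
  obtain ⟨k, hk, hxk⟩ := exists_mem_W h0 h1 hx
  have h2 := branch_F h0 h1 hk hxk
  have h3 := mul_le_mul_of_nonneg_right (le_ratio h1 k) (mapsTo_F h0 h1 hx).1.le
  rw [branch] at h2
  rw [inv_mul_eq_div, le_div_iff₀ hq]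
  nlinarith [pow_pos h0 k]

lemma iterate_le {x : ℝ} (hx : x ∈ Ioc (0 : ℝ) 1) (n : ℕ) :
    (F q)^[n] x ≤ (q * (1 - q))⁻¹ ^ n * x := by
  have hq : 0 < q * (1 - q) := mul_pos h0 (by linarith)
  induction n with
  | zero => simp
  | succ n ih =>
    rw [Function.iterate_succ_apply', pow_succ', mul_assoc]
    exact (F_le h0 h1 (iterate_mem_Ioc h0 h1 hx n)).trans (by gcongr)

/-- Itineraries that gain `J ≥ 1` levels and avoid the state `1`, with a common contraction ratio,
bound the dimension of the escaping set from below: `F q` commutes with multiplication by `q` on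
`(0, q]`, so such itineraries can be concatenated after rescaling. -/
theorem le_dimH_escapingSet_of_words {k₀ n J : ℕ} (hk₀ : 1 ≤ k₀) (hJ : 1 ≤ J)
    {S : Finset (List ℕ)} (hS : S ⊆ words k₀ (n + 1) (k₀ + J)) (hS2 : ∀ l ∈ S, ∀ j ∈ l, 2 ≤ j)
    {ρ : ℝ} (hρ : ∀ l ∈ S, (l.map (ratio q)).prod = ρ)
    {s : ℝ} (hs : 0 < s) (hcard : 1 ≤ S.card * (ρ * q ^ J) ^ s) :
    ENNReal.ofReal s ≤ dimH (escapingSet q) := by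
  obtain ⟨E, hEW, hdim, hE⟩ := exists_cantor h0 h1 hk₀ hS hρ hs hcard
  have hE01 : ∀ x ∈ E, x ∈ Ioc (0 : ℝ) 1 := fun x hx => W_subset h0 h1 k₀ (hEW hx)
  refine hdim.trans (dimH_mono fun x hx => ⟨Ioc_subset_Icc_self (hE01 x hx), ?_⟩)
  have hblock : ∀ m : ℕ, ∃ y ∈ E, (F q)^[(n + 1) * m] x = q ^ (J * m) * y := by
    intro m
    induction m with
    | zero => exact ⟨x, hx, by simp⟩
    | succ m ih =>
      obtain ⟨y, hy, hxy⟩ := ih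
      obtain ⟨l, hl, z, hz, rfl⟩ := hE y hy
      have hzW := pow_mul_mem_W h0 hk₀ J (hEW hz)
      refine ⟨z, hz, ?_⟩
      rw [Nat.mul_succ, add_comm, Function.iterate_add_apply, hxy,
        iterate_pow_mul h0 h1 _ (hE01 _ hy) _ fun i hi => ?_,
        iterate_branchComp h0 h1 (hS hl) hzW, Nat.mul_succ, pow_add, mul_assoc]
      obtain ⟨j, hj, hmem⟩ := iterate_branchComp_mem h0 h1 (hS hl) hzW (hS2 l hl) i hi
      refine hmem.2.trans ?_
      simpa using pow_le_pow_of_le_one h0.le h1.le (show 1 ≤ j - 1 by omega)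
  have hq : 0 < q * (1 - q) := mul_pos h0 (by linarith)
  have hq1 : 1 ≤ (q * (1 - q))⁻¹ := (one_le_inv₀ hq).2 (by nlinarith)
  have hbound : ∀ i : ℕ, (F q)^[i] x ≤ (q * (1 - q))⁻¹ ^ (n + 1) * q ^ (i / (n + 1)) := by
    intro i
    obtain ⟨y, hy, hxy⟩ := hblock (i / (n + 1))
    have hi : (F q)^[i] x = (F q)^[i % (n + 1)] ((F q)^[(n + 1) * (i / (n + 1))] x) := by
      rw [← Function.iterate_add_apply, Nat.mod_add_div]
    rw [hi]
    refine (iterate_le h0 h1 (iterate_mem_Ioc h0 h1 (hE01 x hx) _) _).trans ?_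
    refine mul_le_mul (pow_le_pow_right₀ hq1 (Nat.mod_lt _ (by omega)).le) ?_
      (iterate_mem_Ioc h0 h1 (hE01 x hx) _).1.le (by positivity)
    rw [hxy]
    calc q ^ (J * (i / (n + 1))) * y ≤ q ^ (J * (i / (n + 1))) * 1 := by
          gcongr
          exact (hE01 y hy).2
      _ = q ^ (J * (i / (n + 1))) := mul_one _
      _ ≤ q ^ (i / (n + 1)) :=
          pow_le_pow_of_le_one h0.le h1.le (Nat.le_mul_of_pos_left _ hJ)
  refine squeeze_zero (fun i => (iterate_mem_Ioc h0 h1 (hE01 x hx) i).1.le) hbound ?_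
  have hdiv : Tendsto (fun i : ℕ => i / (n + 1)) atTop atTop :=
    Nat.tendsto_div_const_atTop (by omega)
  simpa using ((tendsto_pow_atTop_nhds_zero_of_lt_one h0.le h1).comp hdiv).const_mul
    ((q * (1 - q))⁻¹ ^ (n + 1))

end Orbits

/-! ### Covers by cylinders -/

section Covers

variable {q : ℝ} (h0 : 0 < q) (h1 : q < 1)
include h0 h1

/-- The points whose orbit visits only the intervals `W q k` with `k ∈ A`. -/
def confined (q : ℝ) (A : Set ℕ) : Set ℝ :=
  {x ∈ Ioc (0 : ℝ) 1 | ∀ i, ∃ k ∈ A, 1 ≤ k ∧ (F q)^[i] x ∈ W q k}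

lemma F_mem_confined {A : Set ℕ} {x : ℝ} (hx : x ∈ confined q A) : F q x ∈ confined q A := by
  refine ⟨mapsTo_F h0 h1 hx.1, fun i => ?_⟩
  rw [← Function.iterate_succ_apply]
  exact hx.2 (i + 1)

lemma confined_inter_W {A : Set ℕ} {k : ℕ} (hk : 1 ≤ k) (hkA : k ∉ A) :
    confined q A ∩ W q k = ∅ := by
  refine eq_empty_of_forall_notMem fun x ⟨hx, hxk⟩ => hkA ?_
  obtain ⟨j, hj, hj1, hxj⟩ := hx.2 0
  rw [Function.iterate_zero, id_eq] at hxj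
  rwa [← index_eq h0 h1 hk hxk, index_eq h0 h1 hj1 hxj]

lemma le_succ_of_F_mem {j k : ℕ} {x : ℝ} (hk : 1 ≤ k) (hx : x ∈ W q k) (hF : F q x ∈ W q j) :
    k ≤ j + 1 := by
  by_contra h
  obtain ⟨m, rfl⟩ : ∃ m, k = m + 2 := ⟨k - 2, by omega⟩
  have hq : 0 < q * (1 - q) := mul_pos h0 (by linarith)
  have h2 := branch_F h0 h1 hk hx
  have h3 := pow_le_pow_of_le_one h0.le h1.le (show j ≤ m by omega)
  have h4 : q * (1 - q) * q ^ m < q * (1 - q) * F q x := by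
    gcongr
    exact h3.trans_lt hF.1
  rw [branch, ratio, if_neg (by omega)] at h2
  have h5 := hx.2
  rw [show m + 2 - 1 = m + 1 by omega] at h5
  have h6 : q ^ (m + 2) + q * (1 - q) * q ^ m = q ^ (m + 1) := by ring
  linarith

lemma lipschitzWith_branch (k : ℕ) : LipschitzWith (ratio q k).toNNReal (branch q k) := by
  refine LipschitzWith.of_dist_le_mul fun x y => ?_
  rw [Real.coe_toNNReal _ (ratio_pos h0 h1 k).le, Real.dist_eq, Real.dist_eq, branch, branch,
    add_sub_add_left_eq_sub, ← mul_sub, abs_mul, abs_of_pos (ratio_pos h0 h1 k)]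

lemma ediam_branch_image_le (k : ℕ) (t : Set ℝ) :
    Metric.ediam (branch q k '' t) ≤ ENNReal.ofReal (ratio q k) * Metric.ediam t :=
  (lipschitzWith_branch h0 h1 k).ediam_image_le t

omit h0 h1 in
lemma tsum_ofReal_half {c : ℝ} (hc : 0 ≤ c) (m : ℕ) :
    ∑' i : ℕ, ENNReal.ofReal (c * (1 / 2) ^ (m + i)) = ENNReal.ofReal (c * (2 * (1 / 2) ^ m)) := by
  have hs : HasSum (fun i : ℕ => c * (1 / 2 : ℝ) ^ (m + i)) (c * (2 * (1 / 2) ^ m)) := by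
    convert! hasSum_geometric_two.mul_left (c * (1 / 2 : ℝ) ^ m) using 1
    · ext i
      rw [pow_add]
      ring
    · ring
  rw [← ENNReal.ofReal_tsum_of_nonneg (fun i => by positivity) hs.summable, hs.tsum_eq]

/-- Covers by cylinders of depth `n`. The weights `2 ^ (-k)` are a supersolution for the transfer
operator that sends `h` to `k ↦ (ratio q k) ^ s * ∑ j, h j`, the sum being over the possible
successors `j` of `k`. -/
theorem exists_cover {A : Set ℕ} {C θ s : ℝ} (hC : 0 ≤ C) (hθ : 0 ≤ θ) (hs : 0 ≤ s)
    (hbase : ∀ k ∈ A, 1 ≤ k → (q ^ (k - 1)) ^ s ≤ C * (1 / 2) ^ k)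
    (hone : 1 ∈ A → 2 * (1 - q) ^ s ≤ θ) (htwo : 4 * (q * (1 - q)) ^ s ≤ θ) (n : ℕ) :
    ∀ k, 1 ≤ k → ∃ (ι : Type) (_ : Countable ι) (t : ι → Set ℝ),
      confined q A ∩ W q k ⊆ ⋃ i, t i ∧
      (∀ i, Metric.ediam (t i) ≤ ENNReal.ofReal ((1 - q) ^ n)) ∧
      ∑' i, Metric.ediam (t i) ^ s ≤ ENNReal.ofReal (C * θ ^ n * (1 / 2) ^ k) := by
  have hq : 0 < 1 - q := by linarith
  induction n with
  | zero =>
    intro k hk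
    have hle : q ^ (k - 1) ≤ 1 := pow_le_one₀ h0.le h1.le
    by_cases hkA : k ∈ A
    · have hd : Metric.ediam (W q k) ≤ ENNReal.ofReal (q ^ (k - 1)) := by
        rw [W, Real.ediam_Ioc]
        exact ENNReal.ofReal_le_ofReal (by linarith [pow_pos h0 k])
      refine ⟨Unit, inferInstance, fun _ => W q k, ?_, fun _ => ?_, ?_⟩
      · rw [iUnion_const]
        exact inter_subset_right
      · exact hd.trans (ENNReal.ofReal_le_ofReal (by simpa using hle))
      · rw [tsum_fintype, Finset.sum_const, Finset.card_univ, Fintype.card_unit, one_smul,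
          pow_zero, mul_one]
        calc Metric.ediam (W q k) ^ s ≤ ENNReal.ofReal (q ^ (k - 1)) ^ s :=
              ENNReal.rpow_le_rpow hd hs
          _ = ENNReal.ofReal ((q ^ (k - 1)) ^ s) :=
              ENNReal.ofReal_rpow_of_nonneg (by positivity) hs
          _ ≤ _ := ENNReal.ofReal_le_ofReal (hbase k hkA hk)
    · refine ⟨Empty, inferInstance, fun _ => ∅, ?_, fun i => i.elim, by simp⟩
      rw [confined_inter_W h0 h1 hk hkA]
      exact empty_subset _
  | succ n ih =>
    intro k hk
    by_cases hkA : k ∈ A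
    swap
    · refine ⟨Empty, inferInstance, fun _ => ∅, ?_, fun i => i.elim, by simp⟩
      rw [confined_inter_W h0 h1 hk hkA]
      exact empty_subset _
    -- the possible successors of `k` are the states `m + i`
    let m := max (k - 1) 1
    choose ι hι t hcov hdiam hsum using fun i : ℕ => ih (m + i) (by omega)
    have hc := ratio_pos h0 h1 k
    refine ⟨Σ i, ι i, inferInstance, fun p => branch q k '' t p.1 p.2, ?_, ?_, ?_⟩
    · rintro x ⟨hx, hxk⟩
      have hFx := F_mem_confined h0 h1 hx
      obtain ⟨j, hj, hj1, hxj⟩ := hFx.2 0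
      have hkj := le_succ_of_F_mem h0 h1 hk hxk hxj
      obtain ⟨i, rfl⟩ : ∃ i, j = m + i := ⟨j - m, by omega⟩
      obtain ⟨a, ha⟩ := mem_iUnion.1 (hcov i ⟨hFx, hxj⟩)
      exact mem_iUnion.2 ⟨⟨i, a⟩, F q x, ha, branch_F h0 h1 hk hxk⟩
    · rintro ⟨i, a⟩
      refine (ediam_branch_image_le h0 h1 k _).trans ?_
      rw [pow_succ', ENNReal.ofReal_mul hq.le]
      exact mul_le_mul' (ENNReal.ofReal_le_ofReal (ratio_le h1 k)) (hdiam i a)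
    · have hterm : ∀ p : Σ i, ι i, Metric.ediam (branch q k '' t p.1 p.2) ^ s ≤
          ENNReal.ofReal (ratio q k ^ s) * Metric.ediam (t p.1 p.2) ^ s := by
        intro p
        rw [← ENNReal.ofReal_rpow_of_nonneg hc.le hs, ← ENNReal.mul_rpow_of_nonneg _ _ hs]
        exact ENNReal.rpow_le_rpow (ediam_branch_image_le h0 h1 k _) hs
      have hweight : ratio q k ^ s * (2 * (1 / 2) ^ m) ≤ θ * (1 / 2) ^ k := by
        rcases Nat.lt_or_ge k 2 with h | h
        · obtain rfl : k = 1 := by omega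
          have := hone hkA
          simp only [ratio, if_pos, m]
          norm_num
          linarith
        · obtain ⟨a, rfl⟩ : ∃ a, k = a + 2 := ⟨k - 2, by omega⟩
          have hm : m = a + 1 := by omega
          rw [hm, ratio, if_neg (by omega), pow_succ, pow_succ _ (a + 1), pow_succ]
          nlinarith [pow_pos (show (0 : ℝ) < 1 / 2 by norm_num) a]
      calc ∑' p : Σ i, ι i, Metric.ediam (branch q k '' t p.1 p.2) ^ s
          ≤ ∑' p : Σ i, ι i, ENNReal.ofReal (ratio q k ^ s) * Metric.ediam (t p.1 p.2) ^ s :=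
            ENNReal.tsum_le_tsum hterm
        _ = ENNReal.ofReal (ratio q k ^ s) * ∑' i, ∑' a, Metric.ediam (t i a) ^ s := by
            rw [ENNReal.tsum_mul_left, ENNReal.tsum_sigma']
        _ ≤ ENNReal.ofReal (ratio q k ^ s) *
              ∑' i : ℕ, ENNReal.ofReal (C * θ ^ n * (1 / 2) ^ (m + i)) := by
            gcongr with i
            exact hsum i
        _ = ENNReal.ofReal (C * θ ^ n * (ratio q k ^ s * (2 * (1 / 2) ^ m))) := by
            rw [tsum_ofReal_half (by positivity), ← ENNReal.ofReal_mul (by positivity)]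
            ring_nf
        _ ≤ ENNReal.ofReal (C * θ ^ n * (θ * (1 / 2) ^ k)) := by gcongr
        _ = _ := by
            rw [pow_succ]
            ring_nf

theorem dimH_confined_le {A : Set ℕ} {C θ s : ℝ} (hC : 0 ≤ C) (hθ : 0 ≤ θ) (hθ1 : θ < 1)
    (hs : 0 ≤ s) (hbase : ∀ k ∈ A, 1 ≤ k → (q ^ (k - 1)) ^ s ≤ C * (1 / 2) ^ k)
    (hone : 1 ∈ A → 2 * (1 - q) ^ s ≤ θ) (htwo : 4 * (q * (1 - q)) ^ s ≤ θ) :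
    dimH (confined q A) ≤ ENNReal.ofReal s := by
  have hsub : confined q A ⊆ ⋃ k : ℕ, confined q A ∩ W q (k + 1) := by
    intro x hx
    obtain ⟨k, hk, hxk⟩ := exists_mem_W h0 h1 hx.1
    exact mem_iUnion.2 ⟨k - 1, hx, by rwa [Nat.sub_add_cancel hk]⟩
  refine (dimH_mono hsub).trans ?_
  rw [dimH_iUnion]
  refine iSup_le fun k => dimH_le_of_hausdorffMeasure_ne_top (d := s.toNNReal) ?_
  rw [Real.coe_toNNReal _ hs]
  choose ι hι t hcov hdiam hsum using fun n =>
    exists_cover h0 h1 hC hθ hs hbase hone htwo n (k + 1) (by omega)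
  have hr : Tendsto (fun n : ℕ => ENNReal.ofReal ((1 - q) ^ n)) atTop (𝓝 0) := by
    rw [← ENNReal.ofReal_zero]
    exact ENNReal.tendsto_ofReal
      (tendsto_pow_atTop_nhds_zero_of_lt_one (by linarith) (by linarith))
  have hle := MeasureTheory.Measure.hausdorffMeasure_le_liminf_tsum s (confined q A ∩ W q (k + 1))
    _ hr t (Eventually.of_forall hdiam) (Eventually.of_forall hcov)
  have hlim : liminf (fun n => ∑' i, Metric.ediam (t n i) ^ s) atTop ≤ ENNReal.ofReal C := by
    refine liminf_le_of_frequently_le' (Frequently.of_forall fun n => (hsum n).trans ?_)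
    refine ENNReal.ofReal_le_ofReal ?_
    calc C * θ ^ n * (1 / 2) ^ (k + 1) ≤ C * 1 * 1 := by
          gcongr
          · exact pow_le_one₀ hθ hθ1.le
          · exact pow_le_one₀ (by norm_num) (by norm_num)
      _ = C := by ring
  exact ((hle.trans hlim).trans_lt ENNReal.ofReal_lt_top).ne

lemma dimH_preimage_F_le (T : Set ℝ) : dimH (Ioc (0 : ℝ) 1 ∩ F q ⁻¹' T) ≤ dimH T := by
  have hsub : Ioc (0 : ℝ) 1 ∩ F q ⁻¹' T ⊆ ⋃ k : ℕ, branch q k '' T := by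
    rintro x ⟨hx, hxT⟩
    obtain ⟨k, hk, hxk⟩ := exists_mem_W h0 h1 hx
    exact mem_iUnion.2 ⟨k, F q x, hxT, branch_F h0 h1 hk hxk⟩
  refine (dimH_mono hsub).trans ?_
  rw [dimH_iUnion]
  refine iSup_le fun k => (lipschitzWith_branch h0 h1 k).dimH_image_le T

end Covers

/-! ### Upper bounds -/

section UpperBounds

variable {q : ℝ} (h0 : 0 < q) (h1 : q < 1)
include h0 h1

/-- The condition on the exponent passes from the ratio `q * (1 - q)` to a ratio `x` with
`x ^ 2 ≤ q * (1 - q)`. -/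
lemma two_mul_rpow_lt_one {x s : ℝ} (hx0 : 0 < x) (hx : x * x ≤ q * (1 - q)) (hs : 0 ≤ s)
    (h : 4 * (q * (1 - q)) ^ s < 1) : 2 * x ^ s < 1 := by
  have h2 : x ^ s * x ^ s ≤ (q * (1 - q)) ^ s := by
    rw [← Real.mul_rpow hx0.le hx0.le]
    exact Real.rpow_le_rpow (by positivity) hx hs
  nlinarith [Real.rpow_pos_of_pos hx0 s]

/-- A compact invariant set without `0` stays above some `q ^ M`, so finitely many states occur. -/
theorem hypDim_le (hq : 1 / 2 ≤ q) {s : ℝ} (hs : 0 ≤ s) (h : 4 * (q * (1 - q)) ^ s < 1) :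
    hypDim q ≤ ENNReal.ofReal s := by
  have hq1 : 0 < 1 - q := by linarith
  refine iSup₂_le fun K ⟨hK01, hKc, hKmaps, hK0⟩ => ?_
  obtain ⟨ε, hε, hball⟩ := Metric.isOpen_iff.1 hKc.isClosed.isOpen_compl 0 hK0
  obtain ⟨M, hM⟩ := exists_pow_lt_of_lt_one hε h1
  have hKM : ∀ x ∈ K, q ^ M < x := by
    intro x hx
    by_contra hlt
    refine hball (a := x) ?_ hx
    rw [mem_ball_zero_iff, Real.norm_of_nonneg (hK01 hx).1]
    linarith
  have hsub : K ⊆ confined q {k | k ≤ M} := by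
    have hpos : ∀ x ∈ K, x ∈ Ioc (0 : ℝ) 1 := fun x hx =>
      ⟨(pow_pos h0 M).trans (hKM x hx), (hK01 hx).2⟩
    refine fun x hx => ⟨hpos x hx, fun i => ?_⟩
    have hi : (F q)^[i] x ∈ K := hKmaps.iterate i hx
    obtain ⟨k, hk, hxk⟩ := exists_mem_W h0 h1 (hpos _ hi)
    refine ⟨k, ?_, hk, hxk⟩
    by_contra hlt
    rw [mem_ofPred_eq, not_le] at hlt
    have := pow_le_pow_of_le_one h0.le h1.le (show M ≤ k - 1 by omega)
    linarith [hxk.2, hKM _ hi]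
  refine (dimH_mono hsub).trans (dimH_confined_le h0 h1 (C := 2 ^ M)
    (θ := max (4 * (q * (1 - q)) ^ s) (2 * (1 - q) ^ s)) (by positivity)
    (le_max_of_le_right (by positivity)) (max_lt h ?_) hs ?_ (fun _ => le_max_right _ _)
    (le_max_left _ _))
  · exact two_mul_rpow_lt_one h0 h1 hq1 (by nlinarith) hs h
  · intro k hk _
    have h2 : (q ^ (k - 1)) ^ s ≤ 1 :=
      Real.rpow_le_one (by positivity) (pow_le_one₀ h0.le h1.le) hs
    have h3 : (2 : ℝ) ^ k * (1 / 2) ^ k = 1 := by rw [← mul_pow]; norm_num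
    have h4 : (2 : ℝ) ^ k ≤ 2 ^ M := pow_le_pow_right₀ (by norm_num) hk
    calc (q ^ (k - 1)) ^ s ≤ (2 : ℝ) ^ k * (1 / 2) ^ k := by rw [h3]; exact h2
      _ ≤ _ := by gcongr

/-- An escaping orbit eventually stays below `q`, that is, in the states `k ≥ 2`. -/
theorem dimH_escapingSet_le (hq : q ≤ 1 / 2) {s : ℝ} (hs : 0 ≤ s)
    (h : 4 * (q * (1 - q)) ^ s < 1) : dimH (escapingSet q) ≤ ENNReal.ofReal s := by
  have hq1 : 0 < 1 - q := by linarith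
  have hconf : dimH (confined q {k | 2 ≤ k}) ≤ ENNReal.ofReal s := by
    refine dimH_confined_le h0 h1 (C := 2) (by norm_num) (by positivity) h hs ?_
      (fun h => absurd h (by simp)) le_rfl
    intro k hk _
    obtain ⟨m, rfl⟩ : ∃ m, k = m + 1 := ⟨k - 1, by omega⟩
    have h2 := two_mul_rpow_lt_one h0 h1 h0 (by nlinarith) hs h
    rw [Nat.add_sub_cancel, ← Real.rpow_natCast, ← Real.rpow_mul h0.le, mul_comm,
      Real.rpow_mul h0.le, Real.rpow_natCast]
    calc (q ^ s) ^ m ≤ (1 / 2) ^ m := by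
          gcongr
          linarith
      _ = _ := by ring
  have hpre : ∀ N : ℕ, dimH (Ioc (0 : ℝ) 1 ∩ (F q)^[N] ⁻¹' confined q {k | 2 ≤ k}) ≤
      ENNReal.ofReal s := by
    intro N
    induction N with
    | zero => exact (dimH_mono inter_subset_right).trans hconf
    | succ N ih =>
      refine (dimH_mono ?_).trans ((dimH_preimage_F_le h0 h1 _).trans ih)
      exact fun x hx => ⟨hx.1, mapsTo_F h0 h1 hx.1, hx.2⟩
  have hsub : escapingSet q ⊆
      {0} ∪ ⋃ N : ℕ, Ioc (0 : ℝ) 1 ∩ (F q)^[N] ⁻¹' confined q {k | 2 ≤ k} := by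
    rintro x ⟨hx01, hlim⟩
    rcases hx01.1.eq_or_lt with rfl | hx0
    · exact Or.inl rfl
    right
    have hx : x ∈ Ioc (0 : ℝ) 1 := ⟨hx0, hx01.2⟩
    obtain ⟨N, hN⟩ := eventually_atTop.1 (hlim.eventually_lt_const h0)
    refine mem_iUnion.2 ⟨N, hx, iterate_mem_Ioc h0 h1 hx N, fun i => ?_⟩
    rw [← Function.iterate_add_apply]
    obtain ⟨k, hk, hxk⟩ := exists_mem_W h0 h1 (iterate_mem_Ioc h0 h1 hx (i + N))
    refine ⟨k, ?_, hk, hxk⟩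
    by_contra hlt
    rw [mem_ofPred_eq, not_le] at hlt
    obtain rfl : k = 1 := by omega
    have h2 := hxk.1
    rw [pow_one] at h2
    exact absurd (hN (i + N) (by omega)) (by linarith)
  refine (dimH_mono hsub).trans ?_
  rw [dimH_union, dimH_singleton, dimH_iUnion]
  exact max_le zero_le (iSup_le hpre)

end UpperBounds

/-! ### Counting itineraries that avoid the state `1` -/

lemma le_of_mem_of_mem_words {k₀ : ℕ} : ∀ {n k : ℕ} {l : List ℕ}, l ∈ words k₀ n k →
    ∀ j ∈ l, k₀ + 1 ≤ j + n
  | 0, _, _, hl, j, hj => by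
    rw [(mem_words_zero.1 hl).2] at hj
    simp at hj
  | n + 1, _, _, hl, j, hj => by
    obtain ⟨i, l', -, -, hl', rfl⟩ := mem_words_succ.1 hl
    rcases List.mem_cons.1 hj with rfl | h
    · have := le_add_of_mem_words hl'
      omega
    · have := le_of_mem_of_mem_words hl' j h
      omega

/-- From a state too high to come down to `0` within `n` steps, every sequence of `n + 1` steps
`≥ -1` is an itinerary. The `choose` counts the sequences with sum `k - k₀`, as the ways to write
`T = k - k₀ + n + 1` as a sum of `n + 1` naturals. -/
lemma choose_le_card_words {k₀ : ℕ} : ∀ {n k T : ℕ}, n + 1 ≤ k₀ → k + n + 1 = k₀ + T →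
    (n + T).choose n ≤ (words k₀ (n + 1) k).card
  | 0, k, T, hn, hk => by
    simp only [Nat.choose_zero_right]
    refine Finset.card_pos.2 ⟨[k₀], mem_words_succ.2 ⟨k₀, [], hn, by omega, ?_, rfl⟩⟩
    exact mem_words_zero.2 ⟨rfl, rfl⟩
  | n + 1, k, T, hn, hk => by
    rw [Finset.card_eq_sum_ones, sum_words_succ]
    simp only [← Finset.card_eq_sum_ones]
    calc (n + 1 + T).choose (n + 1) = ∑ i ∈ Finset.range (T + 1), (i + n).choose n := by
          rw [Nat.sum_range_add_choose]
          congr 1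
          omega
      _ ≤ ∑ i ∈ Finset.range (T + 1), (words k₀ (n + 1) (k₀ - n - 1 + i)).card := by
          refine Finset.sum_le_sum fun i hi => ?_
          rw [add_comm i]
          exact choose_le_card_words (by omega) (by omega)
      _ = ∑ j ∈ Finset.Ico (k₀ - n - 1) (k + 2), (words k₀ (n + 1) j).card := by
          rw [Finset.sum_Ico_eq_sum_range]
          congr 2
          omega
      _ ≤ _ := by
          refine Finset.sum_le_sum_of_subset fun j hj => ?_
          rw [Finset.mem_Ico] at hj
          rw [Finset.mem_Icc]
          omega

lemma prod_ratio_eq (q : ℝ) (l : List ℕ) : (l.map (ratio q)).prod =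
    (1 - q) ^ l.count 1 * (q * (1 - q)) ^ (l.length - l.count 1) := by
  induction l with
  | nil => simp
  | cons j l ih =>
    rw [List.map_cons, List.prod_cons, ih]
    have hle := List.count_le_length (a := 1) (l := l)
    by_cases h : j = 1
    · rw [h, List.count_cons_self, List.length_cons, Nat.add_sub_add_right, ratio, if_pos rfl]
      ring
    · rw [List.count_cons_of_ne h, List.length_cons, Nat.succ_sub hle, ratio, if_neg h,
        Nat.succ_eq_add_one]
      ring

lemma prod_ratio_of_two_le (q : ℝ) {l : List ℕ} (hl : ∀ j ∈ l, 2 ≤ j) :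
    (l.map (ratio q)).prod = (q * (1 - q)) ^ l.length := by
  have h : l.count 1 = 0 := List.count_eq_zero.2 fun h => absurd (hl 1 h) (by norm_num)
  rw [prod_ratio_eq, h]
  simp

lemma eventually_le_mul_pow {c z : ℝ} (hc : 0 < c) (hz : 1 < z) :
    ∀ᶠ n : ℕ in atTop, (n : ℝ) ≤ c * z ^ n := by
  have h := tendsto_pow_const_div_const_pow_of_one_lt 1 hz
  filter_upwards [h.eventually_lt_const hc] with n hn
  rw [pow_one, div_lt_iff₀ (by positivity)] at hn
  exact hn.le

lemma exists_centralBinom {y c : ℝ} (hy : 1 < 4 * y) (hc : 0 < c) :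
    ∃ a : ℕ, 1 ≤ ((2 * a).choose a : ℝ) * (y ^ (a + 1) * c) := by
  have hy0 : 0 < y := by linarith
  obtain ⟨a, ha, ha1⟩ := ((eventually_le_mul_pow (c := y * c / 2) (by positivity) hy).and
    (eventually_ge_atTop 1)).exists
  refine ⟨a, ?_⟩
  have h2 : (4 : ℝ) ^ a ≤ 2 * a * ((2 * a).choose a : ℝ) := by
    have := Nat.four_pow_le_two_mul_self_mul_centralBinom a ha1
    rw [Nat.centralBinom_eq_two_mul_choose] at this
    exact_mod_cast this
  have ha0 : (0 : ℝ) < a := by exact_mod_cast ha1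
  have h3 : (a : ℝ) * 1 ≤ a * (((2 * a).choose a : ℝ) * (y ^ (a + 1) * c)) := by
    calc (a : ℝ) * 1 ≤ y * c / 2 * (4 * y) ^ a := by simpa using ha
      _ = y ^ (a + 1) * c / 2 * 4 ^ a := by rw [mul_pow]; ring
      _ ≤ y ^ (a + 1) * c / 2 * (2 * a * ((2 * a).choose a : ℝ)) := by gcongr
      _ = _ := by ring
  exact le_of_mul_le_mul_left h3 ha0

/-- A family of `N` pieces of ratio `r` whose total length `N * r` is not too small has dimension
close to `1`. -/
lemma one_le_mul_rpow {N r c x s : ℝ} (hN : 0 ≤ N) (hr : 0 < r) (hx : r ≤ x) (hc : c ≤ N * r)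
    (hs : s < 1) (h : 1 ≤ c * x ^ (s - 1)) : 1 ≤ N * r ^ s := by
  have hx0 : 0 < x := hr.trans_le hx
  calc 1 ≤ c * x ^ (s - 1) := h
    _ ≤ N * r * x ^ (s - 1) := by gcongr
    _ ≤ N * r * r ^ (s - 1) :=
        mul_le_mul_of_nonneg_left (Real.rpow_le_rpow_of_nonpos hr hx (by linarith)) (by positivity)
    _ = N * r ^ s := by
        rw [Real.rpow_sub_one hr.ne']
        field_simp

section LowerBounds

variable {q : ℝ} (h0 : 0 < q) (h1 : q < 1)
include h0 h1

/-- Loops of length `a + 1` at the state `a + 2` cannot reach the state `1`; there are at least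
`(2 * a).choose a` of them. -/
theorem le_hypDim {s : ℝ} (hs : 0 < s) (h : 1 < 4 * (q * (1 - q)) ^ s) :
    ENNReal.ofReal s ≤ hypDim q := by
  have hR : 0 < q * (1 - q) := mul_pos h0 (by linarith)
  obtain ⟨a, ha⟩ := exists_centralBinom h one_pos
  refine le_hypDim_of_words h0 h1 (k₀ := a + 2) (n := a) (by omega) Finset.Subset.rfl
    (ρ := (q * (1 - q)) ^ (a + 1)) (fun l hl => ?_) hs ?_
  · rw [prod_ratio_of_two_le, length_of_mem_words hl]
    intro j hj
    have := le_of_mem_of_mem_words hl j hj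
    omega
  · have hcard : (2 * a).choose a ≤ (words (a + 2) (a + 1) (a + 2)).card :=
      (Nat.choose_le_choose a (by omega)).trans
        (choose_le_card_words (n := a) (k := a + 2) (T := a + 1) (by omega) (by omega))
    rw [mul_one] at ha
    rw [← Real.rpow_natCast, ← Real.rpow_mul hR.le, mul_comm ((a + 1 : ℕ) : ℝ), Real.rpow_mul hR.le,
      Real.rpow_natCast]
    refine ha.trans ?_
    gcongr

/-- Itineraries of length `a + 1` that gain one level from the state `a + 2`. -/
theorem le_dimH_escapingSet {s : ℝ} (hs : 0 < s) (h : 1 < 4 * (q * (1 - q)) ^ s) :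
    ENNReal.ofReal s ≤ dimH (escapingSet q) := by
  have hR : 0 < q * (1 - q) := mul_pos h0 (by linarith)
  obtain ⟨a, ha⟩ := exists_centralBinom h (Real.rpow_pos_of_pos h0 s)
  have htwo : ∀ l ∈ words (a + 2) (a + 1) (a + 2 + 1), ∀ j ∈ l, 2 ≤ j := by
    intro l hl j hj
    have := le_of_mem_of_mem_words hl j hj
    omega
  refine le_dimH_escapingSet_of_words h0 h1 (k₀ := a + 2) (n := a) (J := 1) (by omega) le_rfl
    Finset.Subset.rfl htwo (ρ := (q * (1 - q)) ^ (a + 1)) (fun l hl => ?_) hs ?_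
  · rw [prod_ratio_of_two_le q (htwo l hl), length_of_mem_words hl]
  · have hcard : (2 * a).choose a ≤ (words (a + 2) (a + 1) (a + 2 + 1)).card :=
      (Nat.choose_le_choose a (by omega)).trans
        (choose_le_card_words (n := a) (k := a + 3) (T := a + 2) (by omega) (by omega))
    rw [pow_one, Real.mul_rpow (by positivity) h0.le, ← Real.rpow_natCast, ← Real.rpow_mul hR.le,
      mul_comm ((a + 1 : ℕ) : ℝ), Real.rpow_mul hR.le, Real.rpow_natCast]
    refine ha.trans ?_
    have := Real.rpow_pos_of_pos h0 s
    gcongr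

/-- The upper tail of the binomial distribution of parameter `1 - q < 1 / 2`. -/
lemma sum_binomial_tail_le (hq : 1 / 2 < q) (M : ℕ) :
    ∑ a ∈ Finset.Ico M (2 * M + 1), (1 - q) ^ a * q ^ (2 * M - a) * ((2 * M).choose a : ℝ) ≤
      (4 * (q * (1 - q))) ^ M := by
  have hq1 : 0 < 1 - q := by linarith
  calc ∑ a ∈ Finset.Ico M (2 * M + 1), (1 - q) ^ a * q ^ (2 * M - a) * ((2 * M).choose a : ℝ)
      ≤ ∑ a ∈ Finset.Ico M (2 * M + 1), (q * (1 - q)) ^ M * ((2 * M).choose a : ℝ) := by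
        refine Finset.sum_le_sum fun a ha => ?_
        rw [Finset.mem_Ico] at ha
        gcongr
        obtain ⟨b, rfl⟩ := Nat.exists_eq_add_of_le ha.1
        obtain ⟨d, rfl⟩ := Nat.exists_eq_add_of_le (show b ≤ M by omega)
        rw [show 2 * (b + d) - (b + d + b) = d by omega]
        calc (1 - q) ^ (b + d + b) * q ^ d = (1 - q) ^ (b + d) * q ^ d * (1 - q) ^ b := by ring
          _ ≤ (1 - q) ^ (b + d) * q ^ d * q ^ b := by
              gcongr
              linarith
          _ = _ := by
              rw [mul_pow]
              ring
    _ ≤ ∑ a ∈ Finset.range (2 * M + 1), (q * (1 - q)) ^ M * ((2 * M).choose a : ℝ) := by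
        refine Finset.sum_le_sum_of_subset_of_nonneg (fun a ha => ?_) fun _ _ _ => by positivity
        rw [Finset.mem_Ico] at ha
        exact Finset.mem_range.2 ha.2
    _ = _ := by
        rw [← Finset.mul_sum, ← Nat.cast_sum, Nat.sum_range_choose, pow_mul, mul_pow 4]
        push_cast
        ring

/-- A binomial variable of parameter `1 - q < 1 / 2` with `2 * M` trials takes some value below `M`
with probability at least `1 / (2 * M)`. -/
lemma exists_binomial_term (hq : 1 / 2 < q) :
    ∀ᶠ M : ℕ in atTop, ∃ a < M,
      1 / (2 * M) ≤ (1 - q) ^ a * q ^ (2 * M - a) * ((2 * M).choose a : ℝ) := by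
  have hq1 : 0 < 1 - q := by linarith
  have h4 : 4 * (q * (1 - q)) < 1 := by nlinarith [sq_pos_of_pos (sub_pos.2 hq)]
  have hlim := tendsto_pow_atTop_nhds_zero_of_lt_one (by positivity) h4
  filter_upwards [hlim.eventually_le_const (show (0 : ℝ) < 1 / 2 by norm_num),
    eventually_ge_atTop 1] with M hM hM1
  have htotal := add_pow (1 - q) q (2 * M)
  rw [sub_add_cancel, one_pow, Finset.range_eq_Ico,
    ← Finset.sum_Ico_consecutive _ (Nat.zero_le M) (by omega)] at htotal
  have htail := sum_binomial_tail_le h0 h1 hq M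
  have hM0 : (0 : ℝ) < M := by exact_mod_cast hM1
  by_contra! hcon
  have hlow : ∑ a ∈ Finset.Ico 0 M, (1 - q) ^ a * q ^ (2 * M - a) * ((2 * M).choose a : ℝ) <
      ∑ a ∈ Finset.Ico 0 M, 1 / (2 * (M : ℝ)) := by
    refine Finset.sum_lt_sum_of_nonempty ⟨0, Finset.mem_Ico.2 ⟨le_rfl, hM1⟩⟩ fun a ha => ?_
    exact hcon a (Finset.mem_Ico.1 ha).2
  rw [Finset.sum_const, Nat.card_Ico, nsmul_eq_mul, Nat.sub_zero] at hlow
  have : (M : ℝ) * (1 / (2 * M)) = 1 / 2 := by field_simp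
  linarith

/-- Full dimension of the escaping set in the transient case, from the itineraries of length `a + 1`
that gain `2 * M - 2 * a - 1 ≥ 1` levels, with `M` and `a` from `exists_binomial_term`. -/
theorem le_dimH_escapingSet_of_lt_one (hq : 1 / 2 < q) {s : ℝ} (hs : 0 < s) (hs1 : s < 1) :
    ENNReal.ofReal s ≤ dimH (escapingSet q) := by
  have hq1 : 0 < 1 - q := by linarith
  have hz : 1 < q ^ (s - 1) := Real.one_lt_rpow_of_pos_of_lt_one_of_neg h0 h1 (by linarith)
  obtain ⟨M, ⟨⟨a, haM, ha⟩, hM⟩, hM1⟩ := (((exists_binomial_term h0 h1 hq).and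
    (eventually_le_mul_pow (c := (1 - q) / 2) (by positivity) hz)).and
    (eventually_ge_atTop 1)).exists
  obtain ⟨J, hJ⟩ : ∃ J, 2 * M = 2 * a + 1 + J := ⟨2 * M - (2 * a + 1), by omega⟩
  have htwo : ∀ l ∈ words (a + 2) (a + 1) (a + 2 + J), ∀ j ∈ l, 2 ≤ j := by
    intro l hl j hj
    have := le_of_mem_of_mem_words hl j hj
    omega
  refine le_dimH_escapingSet_of_words h0 h1 (k₀ := a + 2) (n := a) (J := J) (by omega) (by omega)
    Finset.Subset.rfl htwo (ρ := (q * (1 - q)) ^ (a + 1)) (fun l hl => ?_) hs ?_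
  · rw [prod_ratio_of_two_le q (htwo l hl), length_of_mem_words hl]
  · have hcard : (2 * M).choose a ≤ (words (a + 2) (a + 1) (a + 2 + J)).card := by
      have := choose_le_card_words (k₀ := a + 2) (n := a) (k := a + 2 + J) (T := a + 1 + J)
        (by omega) (by omega)
      rwa [show a + (a + 1 + J) = 2 * M by omega] at this
    have hr : (q * (1 - q)) ^ (a + 1) * q ^ J = (1 - q) * ((1 - q) ^ a * q ^ (2 * M - a)) := by
      rw [show 2 * M - a = a + 1 + J by omega, mul_pow]
      ring
    have hM0 : (0 : ℝ) < M := by exact_mod_cast hM1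
    refine one_le_mul_rpow (c := (1 - q) / (2 * M)) (x := q ^ M) (by positivity) (by positivity)
      ?_ ?_ hs1 ?_
    · rw [hr]
      calc (1 - q) * ((1 - q) ^ a * q ^ (2 * M - a)) ≤ 1 * (1 * q ^ (2 * M - a)) := by
            gcongr
            · linarith
            · exact pow_le_one₀ hq1.le (by linarith)
        _ = q ^ (2 * M - a) := by ring
        _ ≤ q ^ M := pow_le_pow_of_le_one h0.le h1.le (by omega)
    · rw [hr]
      calc (1 - q) / (2 * M) = (1 - q) * (1 / (2 * M)) := by ring
        _ ≤ (1 - q) * ((1 - q) ^ a * q ^ (2 * M - a) * ((2 * M).choose a : ℝ)) := by gcongr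
        _ = ((2 * M).choose a : ℝ) * ((1 - q) * ((1 - q) ^ a * q ^ (2 * M - a))) := by ring
        _ ≤ _ := by gcongr
    · rw [← Real.rpow_natCast, ← Real.rpow_mul h0.le, mul_comm (M : ℝ), Real.rpow_mul h0.le,
        Real.rpow_natCast, div_mul_eq_mul_div, le_div_iff₀ (by positivity)]
      linarith

end LowerBounds

/-! ### Loops at the state `1` -/

section Loops

variable {q : ℝ} (h0 : 0 < q) (h1 : q < 1)
include h0 h1

/-- The total contraction ratio of the itineraries of length `n` from the state `1` to the state
`k + 1`. Multiplied by `q ^ k`, it is the Lebesgue measure of the set of points of `W q 1`, with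
total mass normalized to `1`, that `(F q)^[n]` sends to `W q (k + 1)`. -/
noncomputable def weight (q : ℝ) (n k : ℕ) : ℝ :=
  ∑ l ∈ words 1 n (k + 1), (l.map (ratio q)).prod

lemma weight_nonneg (n k : ℕ) : 0 ≤ weight q n k :=
  Finset.sum_nonneg fun l _ => (prod_ratio_pos h0 h1 l).le

omit h0 h1 in
lemma weight_zero (q : ℝ) (k : ℕ) : weight q 0 k = if k = 0 then 1 else 0 := by
  rw [weight, words]
  split_ifs with h2 h3 h3 <;> simp_all

omit h0 h1 in
lemma weight_succ (q : ℝ) (n k : ℕ) : weight q (n + 1) k =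
    (1 - q) * weight q n 0 + q * (1 - q) * ∑ i ∈ Finset.range (k + 1), weight q n (i + 1) := by
  have h : weight q (n + 1) k =
      ∑ i ∈ Finset.range (k + 2), ratio q (i + 1) * weight q n i := by
    rw [weight, sum_words_succ]
    simp only [List.map_cons, List.prod_cons, ← Finset.mul_sum]
    rw [← Finset.Ico_add_one_right_eq_Icc, Finset.sum_Ico_eq_sum_range]
    refine Finset.sum_congr (by simp) fun i _ => ?_
    rw [add_comm 1 i, weight]
  rw [h, Finset.sum_range_succ', add_comm, Finset.mul_sum]
  simp [ratio]

/-- The `F q`-invariant density is constant on each interval `W q k` and proportional to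
`(1 - q) ^ (-k)` there; it dominates the densities at all times. -/
lemma weight_le (n : ℕ) : ∀ k, weight q n k ≤ ((1 - q)⁻¹) ^ k := by
  have hq : 0 < 1 - q := by linarith
  have hx : (1 - q) * (1 - q)⁻¹ = 1 := mul_inv_cancel₀ hq.ne'
  induction n with
  | zero =>
    intro k
    rw [weight_zero]
    split_ifs with h
    · simp [h]
    · positivity
  | succ n ih =>
    intro k
    have hgeom : (1 - q) + q * (1 - q) * ∑ i ∈ Finset.range (k + 1), ((1 - q)⁻¹) ^ (i + 1) =
        ((1 - q)⁻¹) ^ k := by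
      induction k with
      | zero =>
        rw [Finset.sum_range_one, zero_add, pow_one, pow_zero]
        linear_combination q * hx
      | succ k ihk =>
        rw [Finset.sum_range_succ, mul_add, ← add_assoc, ihk]
        linear_combination (1 - q)⁻¹ ^ k * (q * (1 - q)⁻¹ - 1) * hx
    rw [weight_succ, ← hgeom]
    have h2 := ih 0
    rw [pow_zero] at h2
    gcongr with i
    · nlinarith
    · exact ih (i + 1)

omit h0 in
/-- The flux of Lebesgue measure through a level in one step. -/
lemma sum_weight_succ (n K : ℕ) :
    ∑ k ∈ Finset.range (K + 1), weight q (n + 1) k * q ^ k =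
      ∑ k ∈ Finset.range (K + 2), weight q n k * q ^ k -
        q ^ (K + 1) * (1 - q)⁻¹ * weight q (n + 1) K := by
  have hx : (1 - q) * (1 - q)⁻¹ = 1 := mul_inv_cancel₀ (by linarith)
  induction K with
  | zero =>
    simp only [Finset.sum_range_succ, Finset.sum_range_zero, weight_succ]
    linear_combination (q * weight q n 0 + q ^ 2 * weight q n 1) * hx
  | succ K ih =>
    have hw : weight q (n + 1) (K + 1) =
        weight q (n + 1) K + q * (1 - q) * weight q n (K + 2) := by
      rw [weight_succ, weight_succ, Finset.sum_range_succ _ (K + 1)]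
      ring
    rw [Finset.sum_range_succ, ih, Finset.sum_range_succ _ (K + 2), hw]
    linear_combination q ^ (K + 1) * (q ^ 2 * weight q n (K + 2) - weight q (n + 1) K) * hx

/-- For `q < 1 / 2` the mass does not escape to high levels. -/
lemma le_sum_weight (hq : q < 1 / 2) (n : ℕ) : ∀ K : ℕ,
    1 - (q * (1 - q)⁻¹) ^ (K + 1) * (1 - q * (1 - q)⁻¹)⁻¹ ≤
      ∑ k ∈ Finset.range (K + 1), weight q n k * q ^ k := by
  have hq1 : 0 < 1 - q := by linarith
  have hρ1 : q * (1 - q)⁻¹ < 1 := by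
    rw [← div_eq_mul_inv, div_lt_one hq1]
    linarith
  have hρ : 0 < 1 - q * (1 - q)⁻¹ := by linarith
  induction n with
  | zero =>
    intro K
    have h2 : ∑ k ∈ Finset.range (K + 1), weight q 0 k * q ^ k = 1 := by
      rw [Finset.sum_range_succ']
      simp [weight_zero]
    rw [h2]
    have : 0 ≤ (q * (1 - q)⁻¹) ^ (K + 1) * (1 - q * (1 - q)⁻¹)⁻¹ := by positivity
    linarith
  | succ n ih =>
    intro K
    rw [sum_weight_succ h1]
    have h2 : q ^ (K + 1) * (1 - q)⁻¹ * weight q (n + 1) K ≤ (q * (1 - q)⁻¹) ^ (K + 1) := by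
      calc q ^ (K + 1) * (1 - q)⁻¹ * weight q (n + 1) K
          ≤ q ^ (K + 1) * (1 - q)⁻¹ * (1 - q)⁻¹ ^ K := by
            gcongr
            exact weight_le h0 h1 (n + 1) K
        _ = _ := by
            rw [mul_pow]
            ring
    have h3 := ih (K + 1)
    have h4 : (q * (1 - q)⁻¹) ^ (K + 1) * (1 - q * (1 - q)⁻¹)⁻¹ =
        (q * (1 - q)⁻¹) ^ (K + 1) +
          (q * (1 - q)⁻¹) ^ (K + 1 + 1) * (1 - q * (1 - q)⁻¹)⁻¹ := by
      linear_combination (q * (1 - q)⁻¹) ^ (K + 1) * mul_inv_cancel₀ hρ.ne'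
    linarith

/-- From the state `k + 1 ≤ d + 1` one can reach the state `1` in exactly `d` steps, each of ratio
at least `q * (1 - q)`. -/
lemma pow_mul_weight_le (d : ℕ) : ∀ n k : ℕ, k ≤ d →
    (q * (1 - q)) ^ d * weight q n k ≤ weight q (n + d) 0 := by
  have hR : 0 < q * (1 - q) := mul_pos h0 (by linarith)
  induction d with
  | zero =>
    intro n k hk
    obtain rfl : k = 0 := by omega
    simp
  | succ d ih =>
    intro n k hk
    have hstep : q * (1 - q) * weight q n k ≤ weight q (n + 1) (k - 1) := by
      rw [weight_succ]
      have hw := weight_nonneg h0 h1 n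
      rcases k.eq_zero_or_pos with rfl | hk0
      · have h2 : 0 ≤ ∑ i ∈ Finset.range (0 - 1 + 1), weight q n (i + 1) :=
          Finset.sum_nonneg fun i _ => hw _
        have h3 : q * (1 - q) * weight q n 0 ≤ (1 - q) * weight q n 0 := by
          gcongr
          · exact hw 0
          · nlinarith
        nlinarith
      · have h2 := Finset.single_le_sum (f := fun i => weight q n (i + 1))
          (fun i _ => hw _) (Finset.mem_range.2 (Nat.lt_succ_self (k - 1)))
        rw [Nat.sub_add_cancel hk0] at h2 ⊢
        rw [Nat.succ_eq_add_one, Nat.sub_add_cancel hk0] at h2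
        have h3 : 0 ≤ (1 - q) * weight q n 0 := mul_nonneg (by linarith) (hw 0)
        nlinarith
    calc (q * (1 - q)) ^ (d + 1) * weight q n k
        = (q * (1 - q)) ^ d * (q * (1 - q) * weight q n k) := by ring
      _ ≤ (q * (1 - q)) ^ d * weight q (n + 1) (k - 1) := by gcongr
      _ ≤ weight q (n + 1 + d) 0 := ih _ _ (by omega)
      _ = _ := by rw [show n + 1 + d = n + (d + 1) by omega]

/-- For `q < 1 / 2` returns to `W q 1` have a positive proportion at all large times. -/
lemma exists_le_weight_zero (hq : q < 1 / 2) :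
    ∃ c > 0, ∀ᶠ n : ℕ in atTop, c ≤ weight q n 0 := by
  have hq1 : 0 < 1 - q := by linarith
  have hρ1 : q * (1 - q)⁻¹ < 1 := by
    rw [← div_eq_mul_inv, div_lt_one hq1]
    linarith
  have hρ : 0 < 1 - q * (1 - q)⁻¹ := by linarith
  obtain ⟨K, hK⟩ := exists_pow_lt_of_lt_one (half_pos hρ) hρ1
  have hhalf : (q * (1 - q)⁻¹) ^ (K + 1) * (1 - q * (1 - q)⁻¹)⁻¹ ≤ 1 / 2 := by
    rw [mul_inv_le_iff₀ hρ]
    have : (q * (1 - q)⁻¹) ^ (K + 1) ≤ (q * (1 - q)⁻¹) ^ K :=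
      pow_le_pow_of_le_one (by positivity) hρ1.le (by omega)
    linarith
  refine ⟨(q * (1 - q)) ^ K * (1 / (2 * (K + 1))), by positivity, ?_⟩
  filter_upwards [eventually_ge_atTop K] with N hN
  obtain ⟨n, rfl⟩ := Nat.exists_eq_add_of_le' hN
  have hsum := le_sum_weight h0 h1 hq n K
  have hex : ∃ k ∈ Finset.range (K + 1), 1 / (2 * ((K : ℝ) + 1)) ≤ weight q n k * q ^ k := by
    refine Finset.exists_le_of_sum_le (by simp) ?_
    rw [Finset.sum_const, Finset.card_range, nsmul_eq_mul]
    push_cast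
    have : ((K : ℝ) + 1) * (1 / (2 * (K + 1))) = 1 / 2 := by field_simp
    linarith
  obtain ⟨k, hk, hle⟩ := hex
  have hw : 1 / (2 * ((K : ℝ) + 1)) ≤ weight q n k :=
    hle.trans (mul_le_of_le_one_right (weight_nonneg h0 h1 n k) (pow_le_one₀ h0.le h1.le))
  refine le_trans ?_ (pow_mul_weight_le h0 h1 K n k (by simpa [Nat.lt_succ_iff] using hk))
  gcongr

/-- Full hyperbolic dimension in the positive recurrent case. The loops at the state `1` of a given
length have few different contraction ratios, since the ratio depends only on the number of visits
to `1`; so those with the most frequent ratio carry a large part of the weight. -/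
theorem le_hypDim_of_lt_one (hq : q < 1 / 2) {s : ℝ} (hs : 0 < s) (hs1 : s < 1) :
    ENNReal.ofReal s ≤ hypDim q := by
  have hq1 : 0 < 1 - q := by linarith
  obtain ⟨c, hc, hev⟩ := exists_le_weight_zero h0 h1 hq
  have hz : 1 < (1 - q) ^ (s - 1) :=
    Real.one_lt_rpow_of_pos_of_lt_one_of_neg hq1 (by linarith) (by linarith)
  obtain ⟨N, ⟨hcN, hN⟩, hN1⟩ := ((hev.and (eventually_le_mul_pow (c := c / 2) (by positivity)
    hz)).and (eventually_ge_atTop 1)).exists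
  obtain ⟨n, rfl⟩ : ∃ n, N = n + 1 := ⟨N - 1, by omega⟩
  obtain ⟨m, hm, hle⟩ := Finset.exists_le_sum_fiber_of_maps_to_of_nsmul_le_sum
    (s := words 1 (n + 1) 1) (t := Finset.range (n + 2)) (f := fun l => l.count 1)
    (w := fun l => (l.map (ratio q)).prod) (b := c / (n + 2))
    (fun l hl => by
      have h2 := List.count_le_length (a := 1) (l := l)
      rw [length_of_mem_words hl] at h2
      exact Finset.mem_range.2 (by omega))
    ⟨0, by simp⟩
    (by
      rw [Finset.card_range, nsmul_eq_mul]
      push_cast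
      rw [mul_div_cancel₀ _ (by positivity)]
      exact hcN)
  set S := (words 1 (n + 1) 1).filter fun l => l.count 1 = m
  have hSsub : S ⊆ words 1 (n + 1) 1 := Finset.filter_subset _ _
  set ρ := (1 - q) ^ m * (q * (1 - q)) ^ (n + 1 - m)
  have hρ : ∀ l ∈ S, (l.map (ratio q)).prod = ρ := by
    intro l hl
    rw [prod_ratio_eq, length_of_mem_words (hSsub hl), (Finset.mem_filter.1 hl).2]
  rw [Finset.sum_congr rfl hρ, Finset.sum_const, nsmul_eq_mul] at hle
  refine le_hypDim_of_words h0 h1 le_rfl hSsub hρ hs ?_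
  refine one_le_mul_rpow (x := (1 - q) ^ (n + 1)) (by positivity) (by positivity) ?_ hle hs1 ?_
  · rw [Finset.mem_range] at hm
    calc ρ = (1 - q) ^ m * (q * (1 - q)) ^ (n + 1 - m) := rfl
      _ ≤ (1 - q) ^ m * (1 - q) ^ (n + 1 - m) := by
          gcongr
          nlinarith
      _ = (1 - q) ^ (n + 1) := by rw [← pow_add, Nat.add_sub_cancel' (by omega)]
  · rw [← Real.rpow_natCast, ← Real.rpow_mul hq1.le, mul_comm ((n + 1 : ℕ) : ℝ),
      Real.rpow_mul hq1.le, Real.rpow_natCast, div_mul_eq_mul_div, le_div_iff₀ (by positivity)]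
    push_cast at hN
    have : (0 : ℝ) ≤ n := Nat.cast_nonneg n
    linarith

end Loops

/-! ### The exponent -/

section Exponent

variable {q : ℝ} (h0 : 0 < q) (h1 : q < 1)
include h0 h1

lemma four_mul_rpow_eq (s : ℝ) :
    4 * (q * (1 - q)) ^ s = Real.exp (Real.log 4 + Real.log (q * (1 - q)) * s) := by
  have hR : 0 < q * (1 - q) := mul_pos h0 (by linarith)
  rw [Real.exp_add, Real.exp_log (by norm_num), Real.rpow_def_of_pos hR]

lemma log_ratio_neg : Real.log (q * (1 - q)) < 0 :=
  Real.log_neg (mul_pos h0 (by linarith)) (by nlinarith)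

lemma four_mul_rpow_lt_one {s : ℝ} (hs : -(Real.log 4 / Real.log (q * (1 - q))) < s) :
    4 * (q * (1 - q)) ^ s < 1 := by
  have hL := log_ratio_neg h0 h1
  rw [four_mul_rpow_eq h0 h1, Real.exp_lt_one_iff]
  rw [← div_neg, div_lt_iff₀ (by linarith)] at hs
  linarith

lemma one_lt_four_mul_rpow {s : ℝ} (hs : s < -(Real.log 4 / Real.log (q * (1 - q)))) :
    1 < 4 * (q * (1 - q)) ^ s := by
  have hL := log_ratio_neg h0 h1
  rw [four_mul_rpow_eq h0 h1, Real.one_lt_exp_iff]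
  rw [← div_neg, lt_div_iff₀ (by linarith)] at hs
  linarith

omit h0 h1 in
lemma le_of_forall_ofReal_lt {t : ℝ} {d : ENNReal}
    (h : ∀ s, 0 < s → s < t → ENNReal.ofReal s ≤ d) : ENNReal.ofReal t ≤ d := by
  rcases le_or_gt t 0 with ht | ht
  · rw [ENNReal.ofReal_of_nonpos ht]
    exact zero_le
  have hlim : Tendsto ENNReal.ofReal (𝓝[<] t) (𝓝 (ENNReal.ofReal t)) :=
    ENNReal.continuous_ofReal.continuousAt.mono_left nhdsWithin_le_nhds
  refine le_of_tendsto hlim ?_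
  filter_upwards [Ioo_mem_nhdsLT ht] with s hs
  exact h s hs.1 hs.2

omit h0 h1 in
lemma le_ofReal_of_forall_gt {t : ℝ} {d : ENNReal}
    (h : ∀ s, t < s → d ≤ ENNReal.ofReal s) : d ≤ ENNReal.ofReal t := by
  have hlim : Tendsto ENNReal.ofReal (𝓝[>] t) (𝓝 (ENNReal.ofReal t)) :=
    ENNReal.continuous_ofReal.continuousAt.mono_left nhdsWithin_le_nhds
  refine ge_of_tendsto hlim ?_
  filter_upwards [self_mem_nhdsWithin] with s hs
  exact h s hs

lemma exponent_nonneg : 0 ≤ -(Real.log 4 / Real.log (q * (1 - q))) :=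
  neg_nonneg.2 (div_nonpos_of_nonneg_of_nonpos (Real.log_nonneg (by norm_num))
    (log_ratio_neg h0 h1).le)

theorem dimH_escapingSet_eq (hq : q ≤ 1 / 2) : dimH (escapingSet q) =
    ENNReal.ofReal (-(Real.log 4 / Real.log (q * (1 - q)))) :=
  le_antisymm
    (le_ofReal_of_forall_gt fun _ hs => dimH_escapingSet_le h0 h1 hq
      ((exponent_nonneg h0 h1).trans hs.le) (four_mul_rpow_lt_one h0 h1 hs))
    (le_of_forall_ofReal_lt fun _ hs0 hs =>
      le_dimH_escapingSet h0 h1 hs0 (one_lt_four_mul_rpow h0 h1 hs))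

theorem hypDim_eq (hq : 1 / 2 ≤ q) : hypDim q =
    ENNReal.ofReal (-(Real.log 4 / Real.log (q * (1 - q)))) :=
  le_antisymm
    (le_ofReal_of_forall_gt fun _ hs => hypDim_le h0 h1 hq
      ((exponent_nonneg h0 h1).trans hs.le) (four_mul_rpow_lt_one h0 h1 hs))
    (le_of_forall_ofReal_lt fun _ hs0 hs =>
      le_hypDim h0 h1 hs0 (one_lt_four_mul_rpow h0 h1 hs))

omit h0 h1 in
lemma dimH_real_le_one (T : Set ℝ) : dimH T ≤ 1 :=
  (dimH_mono (subset_univ T)).trans Real.dimH_univ.le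

omit h0 h1 in
lemma ofReal_exponent_half :
    ENNReal.ofReal (-(Real.log 4 / Real.log ((1 / 2 : ℝ) * (1 - 1 / 2)))) = 1 := by
  have h : Real.log ((1 / 2 : ℝ) * (1 - 1 / 2)) = -Real.log 4 := by
    rw [← Real.log_inv]
    norm_num
  have h4 : Real.log 4 ≠ 0 := (Real.log_pos (by norm_num)).ne'
  rw [h, div_neg, neg_neg, div_self h4, ENNReal.ofReal_one]

theorem dimH_escapingSet_eq_one (hq : 1 / 2 ≤ q) : dimH (escapingSet q) = 1 := by
  rcases hq.eq_or_lt with rfl | hq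
  · rw [dimH_escapingSet_eq h0 h1 le_rfl, ofReal_exponent_half]
  · refine le_antisymm (dimH_real_le_one _) ?_
    rw [← ENNReal.ofReal_one]
    exact le_of_forall_ofReal_lt fun _ => le_dimH_escapingSet_of_lt_one h0 h1 hq

theorem hypDim_eq_one (hq : q ≤ 1 / 2) : hypDim q = 1 := by
  rcases hq.eq_or_lt with rfl | hq
  · rw [hypDim_eq h0 h1 le_rfl, ofReal_exponent_half]
  · refine le_antisymm (iSup₂_le fun K _ => dimH_real_le_one K) ?_
    rw [← ENNReal.ofReal_one]
    exact le_of_forall_ofReal_lt fun _ => le_hypDim_of_lt_one h0 h1 hq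

end Exponent
end PiecewiseLinear

theorem theoremC (lam : ℝ) (h0 : 0 < lam) (h1 : lam < 1) :
    PiecewiseLinear.hypDim (1 - lam) = dimH (PiecewiseLinear.escapingSet lam) ∧
    (lam ≤ 1 / 2 →
      dimH (PiecewiseLinear.escapingSet lam) =
        ENNReal.ofReal (-(Real.log 4 / Real.log (lam * (1 - lam))))) ∧
    (1 / 2 ≤ lam → dimH (PiecewiseLinear.escapingSet lam) = 1) := by
  refine ⟨?_, PiecewiseLinear.dimH_escapingSet_eq h0 h1,
    PiecewiseLinear.dimH_escapingSet_eq_one h0 h1⟩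
  rcases le_total lam (1 / 2) with h | h
  · rw [PiecewiseLinear.dimH_escapingSet_eq h0 h1 h,
      PiecewiseLinear.hypDim_eq (by linarith) (by linarith) (by linarith), sub_sub_cancel,
      mul_comm (1 - lam)]
  · rw [PiecewiseLinear.dimH_escapingSet_eq_one h0 h1 h,
      PiecewiseLinear.hypDim_eq_one (by linarith) (by linarith) (by linarith)]
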